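/- Let $N_5$ be the closed connected non-orientable surface of genus $5$, i.e. the connected sum of five projective planes (the quotient of a closed disc whose boundary is glued according to the word $a_1a_1a_2a_2\cdots a_5a_5$). A triangulation of $N_5$ is a two-dimensional simplicial complex $\Delta$ whose underlying space $|\Delta|$ is homeomorphic to $N_5$. A polyhedral realization of $\Delta$ in $\mathbb R^3$ is a simplexwise linear immersion, i.e. a locally injective map $\phi_\psi\colon|\Delta|\to\mathbb R^3$ that is induced, linearly on each simplex, by an assignment $\psi\colon V\to\mathbb R^3$ of coordinates to the vertices of $\Delta$. A geometric symmetry of it is an isometry $R$ of $\mathbb R^3$ that maps $\phi_\psi(|\Delta|)$ onto itself and is induced by an automorphism $\sigma$ of $\Delta$, i.e. $R(\psi(v))=\psi(\sigma(v))$ for every vertex $v$. At least $10$ triangulations of $N_5$ with $10$ vertices, pairwise non-isomorphic as simplicial complexes, admit polyhedral realizations in $\mathbb R^3$. Moreover, each of these $10$ triangulations has a polyhedral realization with integer vertex coordinates ($\psi\colon V\to\mathbb Z^3$) that possesses a $3$-fold rotational symmetry, i.e. a geometric symmetry that is a rotation of order $3$. -/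

import Mathlib

namespace PolyhedralSurface

/-- Euclidean 3-space. -/
abbrev E3 : Type := EuclideanSpace ℝ (Fin 3)

/-! ### The closed non-orientable surface of genus `h` -/

/-- The side identifications of the `2h`-gon with boundary word `a₁a₁a₂a₂⋯a_ha_h`, the polygon being
the closed unit disc whose boundary circle is divided into `2h` equal arcs: the arc number `2k`,
`k < h`, is glued to the arc number `2k + 1`, both traversed counterclockwise. -/
def crosscapRel (h : ℕ) (x y : Metric.closedBall (0 : ℂ) 1) : Prop :=
  ∃ k : Fin h, ∃ t ∈ Set.Icc (0 : ℝ) 1,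
    (x : ℂ) = Complex.exp (2 * Real.pi * Complex.I * ((2 * (k : ℕ) + t) / (2 * h))) ∧
    (y : ℂ) = Complex.exp (2 * Real.pi * Complex.I * ((2 * (k : ℕ) + 1 + t) / (2 * h)))

/-- The closed non-orientable surface `N_h` of genus `h ≥ 1`, i.e. the connected sum of `h`
projective planes, in its polygonal normal form: the closed disc modulo the equivalence relation
generated by the identifications `a₁a₁a₂a₂⋯a_ha_h` (for `h = 1` this is the disc with antipodal
boundary points identified, the projective plane). -/
def NonorientableSurface (h : ℕ) : Type := Quot (crosscapRel h)

instance (h : ℕ) : TopologicalSpace (NonorientableSurface h) :=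
  inferInstanceAs (TopologicalSpace (Quot (crosscapRel h)))

/-! ### Triangulations -/

section Complex

variable {V W : Type*} [Fintype V]

/-- The underlying space `|Δ|` of a finite simplicial complex, in barycentric coordinates:
points of the standard simplex on the vertex set whose support is a face. It carries the
subspace topology. -/
def space (Δ : AbstractSimplicialComplex V) : Set (V → ℝ) :=
  {x | (∀ v, 0 ≤ x v) ∧ ∑ v, x v = 1 ∧ ∃ s ∈ Δ.faces, ∀ v, v ∈ s ↔ x v ≠ 0}

/-- `Δ` is a triangulation of the topological space `S`: a two-dimensional simplicial complex
whose underlying space is homeomorphic to `S`. All elements of `V` are vertices of `Δ`, so that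
the number of vertices is the cardinality of `V`. -/
def IsTriangulationOf (Δ : AbstractSimplicialComplex V) (S : Type*) [TopologicalSpace S] : Prop :=
  (∀ s ∈ Δ.faces, s.card ≤ 3) ∧ (∃ s ∈ Δ.faces, s.card = 3) ∧ Nonempty (space Δ ≃ₜ S)

/-- A bijection of the vertex sets is an isomorphism of simplicial complexes if it maps exactly
the faces to faces. -/
def IsIso (Δ : AbstractSimplicialComplex V) (Γ : AbstractSimplicialComplex W) (σ : V ≃ W) : Prop :=
  ∀ s : Finset V, s ∈ Δ.faces ↔ s.map σ.toEmbedding ∈ Γ.faces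

/-! ### Realizations and their symmetries -/

/-- The simplexwise linear map `|Δ| → ℝ³` induced by an assignment of coordinates to the
vertices. -/
noncomputable def simplexwiseLinear (Δ : AbstractSimplicialComplex V) (ψ : V → E3) :
    space Δ → E3 :=
  fun x => ∑ v, (x : V → ℝ) v • ψ v

/-- The assignment `ψ` of coordinates to the vertices defines a polyhedral realization of (a
triangulation of a non-orientable surface) `Δ`: the induced simplexwise linear map is a simplexwise
linear immersion, i.e. it is locally injective. -/
def IsImmersion (Δ : AbstractSimplicialComplex V) (ψ : V → E3) : Prop :=
  IsLocallyInjective (simplexwiseLinear Δ ψ)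

/-- The isometry `R` is a geometric symmetry of the realization of `Δ` given by `ψ`: it maps the
image of `|Δ|` onto itself and is induced by an automorphism of `Δ`. -/
def IsGeometricSymmetry (Δ : AbstractSimplicialComplex V) (ψ : V → E3) (R : E3 ≃ᵃⁱ[ℝ] E3) : Prop :=
  R '' Set.range (simplexwiseLinear Δ ψ) = Set.range (simplexwiseLinear Δ ψ) ∧
    ∃ σ : V ≃ V, IsIso Δ Δ σ ∧ ∀ v, R (ψ v) = ψ (σ v)

end Complex

/-- A 3-fold rotation of Euclidean 3-space: an orientation-preserving isometry of order 3
(an isometry of finite order has a fixed point, so this is a rotation by `±2π/3` about a line). -/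
def IsThreefoldRotation (R : E3 ≃ᵃⁱ[ℝ] E3) : Prop :=
  LinearMap.det (R.linearIsometryEquiv.toLinearEquiv : E3 →ₗ[ℝ] E3) = 1 ∧ orderOf R = 3

end PolyhedralSurface

/-!
A bistellar move replaces the join `A * ∂B` in a complex by `∂A * B`; both are balls with the same
boundary, so the underlying space does not change up to homeomorphism, and the homeomorphism is the
identity away from the move. Gluing the sides of a triangulated 30-gon according to
`a₁a₁a₂a₂⋯a₅a₅` triangulates `N₅` with 42 vertices; bistellar moves reduce the number of vertices
to ten, and flips of edges lead from there to each of the ten triangulations.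

The rotation that permutes the coordinates cyclically induces an automorphism of each of them. A
simplexwise linear map is locally injective if it is injective on every vertex star, that is, if the
cones over any two triangles at a vertex meet only in the cone over their common face. The edge
vectors at the vertex satisfy, up to scaling, a single linear relation, whose coefficients are
minors by Cramer's rule, and their signs decide this. The triangulations are distinguished by an
invariant built from the degrees of the vertices at the edges that can be flipped.
-/

namespace PolyhedralSurface

open Finset

/-! ### Carriers and bistellar moves -/

section Bistellar

variable {V : Type*} {A B : Finset V} {F G : Set (Finset V)} {x : V → ℝ}

/-- The homeomorphism `e` and its inverse fix all points supported in the vertex set `Z`. -/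
def FixesSupportedIn (Z : Set V) {X Y : Set (V → ℝ)} (e : X ≃ₜ Y) : Prop :=
  (∀ x : X, Function.support x.1 ⊆ Z → (e x).1 = x.1) ∧
    ∀ y : Y, Function.support y.1 ⊆ Z → (e.symm y).1 = y.1

lemma FixesSupportedIn.trans {Z : Set V} {X Y T : Set (V → ℝ)} {e : X ≃ₜ Y} {f : Y ≃ₜ T}
    (he : FixesSupportedIn Z e) (hf : FixesSupportedIn Z f) : FixesSupportedIn Z (e.trans f) := by
  refine ⟨fun x hx => ?_, fun y hy => ?_⟩
  · have hex := he.1 x hx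
    exact (hf.1 (e x) (by rwa [hex])).trans hex
  · have hfy := hf.2 y hy
    exact (he.2 (f.symm y) (by rwa [hfy])).trans hfy

lemma inf'_eq_zero_of_support_subset (hA : A.Nonempty) {s : Set V} (hAs : ¬ (A : Set V) ⊆ s)
    (hx : ∀ v, 0 ≤ x v) (hs : Function.support x ⊆ s) : A.inf' hA x = 0 := by
  obtain ⟨u, hu, hus⟩ := Set.not_subset.1 hAs
  have hxu : x u = 0 := not_not.1 fun hne => hus (hs hne)
  exact le_antisymm (hxu ▸ inf'_le x hu) (le_inf' hA x fun v _ => hx v)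

variable [DecidableEq V]

/-- The piecewise linear map behind a bistellar move: the part common to all coordinates in `A` is
removed and distributed evenly over `B`. -/
noncomputable def exchange (A B : Finset V) (hA : A.Nonempty) (x : V → ℝ) : V → ℝ := fun v =>
  x v - (if v ∈ A then A.inf' hA x else 0) + (if v ∈ B then (#A : ℝ) / #B * A.inf' hA x else 0)

lemma continuous_exchange (hA : A.Nonempty) : Continuous (exchange A B hA) := by
  have : Continuous fun x : V → ℝ => A.inf' hA x :=
    Continuous.finset_inf'_apply hA fun i _ => continuous_apply i
  refine continuous_pi fun v => ?_
  unfold exchange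
  split_ifs <;> fun_prop

lemma exchange_eq_self (hA : A.Nonempty) (h : A.inf' hA x = 0) : exchange A B hA x = x := by
  funext v
  simp [exchange, h]

lemma inf'_exchange (hA : A.Nonempty) (hB : B.Nonempty) (hAB : Disjoint A B)
    (h : B.inf' hB x = 0) : B.inf' hB (exchange A B hA x) = (#A : ℝ) / #B * A.inf' hA x := by
  have hv : ∀ v ∈ B, exchange A B hA x v = x v + (#A : ℝ) / #B * A.inf' hA x := fun v hv => by
    simp [exchange, hv, disjoint_right.1 hAB hv]
  apply le_antisymm
  · obtain ⟨u, hu, hux⟩ := exists_mem_eq_inf' hB x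
    refine (inf'_le _ hu).trans ?_
    rw [hv u hu, ← hux, h, zero_add]
  · refine le_inf' hB _ fun v hvB => ?_
    rw [hv v hvB]
    linarith [inf'_le x hvB]

lemma exchange_exchange (hA : A.Nonempty) (hB : B.Nonempty) (hAB : Disjoint A B)
    (h : B.inf' hB x = 0) : exchange B A hB (exchange A B hA x) = x := by
  have ha : (#A : ℝ) ≠ 0 := by exact_mod_cast hA.card_ne_zero
  have hb : (#B : ℝ) ≠ 0 := by exact_mod_cast hB.card_ne_zero
  funext v
  rw [exchange, inf'_exchange hA hB hAB h]
  by_cases hvA : v ∈ A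
  · have hvB := disjoint_left.1 hAB hvA
    simp only [exchange, hvA, hvB, if_true, if_false]
    field_simp
    ring
  · by_cases hvB : v ∈ B <;> simp [exchange, hvA, hvB]

lemma exchange_nonneg (hA : A.Nonempty) (hx : ∀ v, 0 ≤ x v) (v : V) : 0 ≤ exchange A B hA x v := by
  have hm : 0 ≤ A.inf' hA x := le_inf' hA x fun v _ => hx v
  refine add_nonneg ?_ ?_
  · split_ifs with h
    · exact sub_nonneg.2 (inf'_le x h)
    · simpa using hx v
  · split_ifs <;> positivity

lemma sum_exchange [Fintype V] (hA : A.Nonempty) (hB : B.Nonempty) :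
    ∑ v, exchange A B hA x v = ∑ v, x v := by
  have hb : (#B : ℝ) ≠ 0 := by exact_mod_cast hB.card_ne_zero
  simp only [exchange, sum_add_distrib, sum_sub_distrib, sum_ite_mem, univ_inter, sum_const,
    nsmul_eq_mul]
  field_simp
  ring

lemma exists_support_exchange_subset (hA : A.Nonempty) {t : Finset V} (hAt : A ⊆ t)
    (hs : Function.support x ⊆ t) :
    ∃ u ∈ A, Function.support (exchange A B hA x) ⊆ ↑(t.erase u ∪ B) := by
  obtain ⟨u, hu, hux⟩ := exists_mem_eq_inf' hA x
  refine ⟨u, hu, fun v hv => ?_⟩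
  contrapose! hv
  simp only [coe_union, coe_erase, Set.mem_union, Set.mem_sdiff, mem_coe, Set.mem_singleton_iff,
    not_or, not_and, not_not] at hv
  rw [Function.mem_support, not_not, exchange, if_neg hv.2, add_zero]
  by_cases hvt : v ∈ t
  · rw [hv.1 hvt, if_pos hu, hux, sub_self]
  · rw [if_neg fun hvA => hvt (hAt hvA), sub_zero]
    exact not_not.1 fun hne => hvt (hs hne)

/-- The facets after the bistellar move that replaces the simplex `A` by the simplex `B`: in each
facet containing `A`, one vertex of `A` is traded for `B`, in all possible ways. -/
def bistellarMove (A B : Finset V) (F : Set (Finset V)) : Set (Finset V) :=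
  {s | (s ∈ F ∧ ¬ A ⊆ s) ∨ ∃ t ∈ F, A ⊆ t ∧ ∃ u ∈ A, t.erase u ∪ B = s}

/-- The condition under which `bistellarMove A B F` is a bistellar move: in the complex generated by
`F`, `B` is not a face, but the join of a facet containing `A` with a proper face of `B` is covered
by facets. -/
structure IsBistellar (A B : Finset V) (F : Set (Finset V)) : Prop where
  nonempty_left : A.Nonempty
  nonempty_right : B.Nonempty
  disjoint : Disjoint A B
  not_subset : ∀ t ∈ F, ¬ B ⊆ t
  exists_erase_subset : ∀ t ∈ F, A ⊆ t → ∀ w ∈ B, ∃ t' ∈ F, (t ∪ B).erase w ⊆ t'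

/-- The properties of the facets `F` and `G` before and after a bistellar move replacing `A` by `B`
which ensure that `exchange A B` maps the one underlying space to the other; the inverse
is obtained from the same properties for `B`, `A`, `G`, `F`. -/
structure MovesTo (A B : Finset V) (F G : Set (Finset V)) : Prop where
  not_subset : ∀ t ∈ F, ¬ B ⊆ t
  keep : ∀ t ∈ F, ¬ A ⊆ t → ∃ t' ∈ G, t ⊆ t'
  replace : ∀ t ∈ F, A ⊆ t → ∀ u ∈ A, ∃ t' ∈ G, t.erase u ∪ B ⊆ t'

lemma IsBistellar.movesTo (h : IsBistellar A B F) : MovesTo A B F (bistellarMove A B F) where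
  not_subset := h.not_subset
  keep t ht hA := ⟨t, Or.inl ⟨ht, hA⟩, Subset.rfl⟩
  replace t ht hA u hu := ⟨_, Or.inr ⟨t, ht, hA, u, hu, rfl⟩, Subset.rfl⟩

lemma IsBistellar.movesTo_symm (h : IsBistellar A B F) : MovesTo B A (bistellarMove A B F) F where
  not_subset := by
    rintro _ (⟨-, hA⟩ | ⟨t, -, -, u, hu, rfl⟩) hsub
    · exact hA hsub
    · rcases mem_union.1 (hsub hu) with hu' | hu'
      · exact notMem_erase u t hu'
      · exact disjoint_left.1 h.disjoint hu hu'
  keep := by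
    rintro s (⟨hs, -⟩ | ⟨t, -, -, u, -, rfl⟩) hB
    · exact ⟨s, hs, Subset.rfl⟩
    · exact absurd subset_union_right hB
  replace := by
    rintro s (⟨hs, -⟩ | ⟨t, ht, hA, u, -, rfl⟩) hB w hw
    · exact absurd hB (h.not_subset s hs)
    · obtain ⟨t', ht', hsub⟩ := h.exists_erase_subset t ht hA w hw
      refine ⟨t', ht', Subset.trans ?_ hsub⟩
      rw [subset_erase]
      refine ⟨union_subset ((erase_subset _ _).trans ?_) (hA.trans subset_union_left), ?_⟩
      · exact union_subset_union_left (erase_subset _ _)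
      · simp [disjoint_right.1 h.disjoint hw]

variable [Fintype V]

/-- The underlying space, in barycentric coordinates, of the complex generated by the facets `F`. -/
def carrier (F : Set (Finset V)) : Set (V → ℝ) :=
  {x | x ∈ stdSimplex ℝ V ∧ ∃ t ∈ F, Function.support x ⊆ t}

lemma MovesTo.exchange_mem (h : MovesTo A B F G) (hA : A.Nonempty) (hB : B.Nonempty)
    (hx : x ∈ carrier F) : exchange A B hA x ∈ carrier G := by
  obtain ⟨⟨h0, h1⟩, t, ht, hs⟩ := hx
  refine ⟨⟨exchange_nonneg hA h0, (sum_exchange hA hB).trans h1⟩, ?_⟩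
  by_cases hAt : A ⊆ t
  · obtain ⟨u, hu, hsu⟩ := exists_support_exchange_subset (B := B) hA hAt hs
    obtain ⟨t', ht', hsub⟩ := h.replace t ht hAt u hu
    exact ⟨t', ht', hsu.trans (coe_subset.2 hsub)⟩
  · obtain ⟨t', ht', hsub⟩ := h.keep t ht hAt
    rw [exchange_eq_self hA
      (inf'_eq_zero_of_support_subset hA (coe_subset.not.2 hAt) h0 hs)]
    exact ⟨t', ht', hs.trans (coe_subset.2 hsub)⟩

lemma MovesTo.exchange_exchange (h : MovesTo A B F G) (hA : A.Nonempty) (hB : B.Nonempty)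
    (hAB : Disjoint A B) (hx : x ∈ carrier F) : exchange B A hB (exchange A B hA x) = x := by
  obtain ⟨⟨h0, -⟩, t, ht, hs⟩ := hx
  exact PolyhedralSurface.exchange_exchange hA hB hAB
    (inf'_eq_zero_of_support_subset hB (coe_subset.not.2 (h.not_subset t ht)) h0 hs)

/-- The homeomorphism of the underlying spaces given by a bistellar move. -/
noncomputable def IsBistellar.homeomorph (h : IsBistellar A B F) :
    carrier F ≃ₜ carrier (bistellarMove A B F) where
  toFun x := ⟨_, h.movesTo.exchange_mem h.nonempty_left h.nonempty_right x.2⟩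
  invFun y := ⟨_, h.movesTo_symm.exchange_mem h.nonempty_right h.nonempty_left y.2⟩
  left_inv x := Subtype.ext (h.movesTo.exchange_exchange _ h.nonempty_right h.disjoint x.2)
  right_inv y :=
    Subtype.ext (h.movesTo_symm.exchange_exchange _ h.nonempty_left h.disjoint.symm y.2)
  continuous_toFun := ((continuous_exchange _).comp continuous_subtype_val).subtype_mk _
  continuous_invFun := ((continuous_exchange _).comp continuous_subtype_val).subtype_mk _

lemma IsBistellar.fixesSupportedIn {Z : Set V} (h : IsBistellar A B F) (hA : ¬ (A : Set V) ⊆ Z)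
    (hB : ¬ (B : Set V) ⊆ Z) : FixesSupportedIn Z h.homeomorph :=
  ⟨fun x hx => exchange_eq_self _ (inf'_eq_zero_of_support_subset h.nonempty_left hA x.2.1.1 hx),
    fun y hy => exchange_eq_self _ (inf'_eq_zero_of_support_subset h.nonempty_right hB y.2.1.1 hy)⟩

end Bistellar

/-! ### Vertex sets as bit masks -/

section Masks

variable {n k : ℕ} {a b m : ℕ} {L L' : List ℕ}

/-- The set of vertices encoded by a bit mask, a form in which the kernel computes fast. -/
def bits (n m : ℕ) : Finset (Fin n) := univ.filter fun v => m.testBit v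

/-- The vertices encoded by a bit mask, in increasing order. -/
def bitList (n m : ℕ) : List (Fin n) := (List.finRange n).filter fun v => m.testBit v

/-- The bit mask of a list of vertices. -/
def mask (l : List (Fin n)) : ℕ := l.foldr (fun v m => 2 ^ v.val ||| m) 0

/-- The facets encoded by a list of bit masks. -/
def facets (n : ℕ) (L : List ℕ) : Set (Finset (Fin n)) := {t | ∃ m ∈ L, bits n m = t}

@[simp] lemma mem_bits {v : Fin n} : v ∈ bits n m ↔ m.testBit v = true := by
  simp [bits]

@[simp] lemma mem_bitList {v : Fin n} : v ∈ bitList n m ↔ v ∈ bits n m := by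
  simp [bitList]

lemma bits_mask (l : List (Fin n)) : bits n (mask l) = l.toFinset := by
  ext w
  induction l with
  | nil => simp [mask]
  | cons v l ih =>
    rw [mem_bits] at ih
    rw [mem_bits, mask, List.foldr_cons, ← mask, Nat.testBit_or, Bool.or_eq_true, ih,
      Nat.testBit_two_pow]
    simp [Fin.ext_iff, eq_comm (a := w.val)]

lemma bits_or : bits n (a ||| b) = bits n a ∪ bits n b := by
  ext v
  simp [Nat.testBit_or]

lemma bits_and : bits n (a &&& b) = bits n a ∩ bits n b := by
  ext v
  simp [Nat.testBit_and]

lemma bits_xor_two_pow {u : Fin n} (hu : u ∈ bits n m) :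
    bits n (m ^^^ 2 ^ u.val) = (bits n m).erase u := by
  ext v
  rw [mem_bits] at hu
  rw [mem_erase, mem_bits, mem_bits, Nat.testBit_xor, Nat.testBit_two_pow]
  by_cases h : v = u
  · simp [h, hu]
  · simp [h, Fin.val_injective.ne (Ne.symm h)]

lemma bits_mono (h : a &&& b = a) : bits n a ⊆ bits n b := by
  rw [← h, bits_and]
  exact inter_subset_right

lemma and_eq_left_iff_bits_subset (ha : a < 2 ^ n) : a &&& b = a ↔ bits n a ⊆ bits n b := by
  refine ⟨bits_mono, fun h => Nat.eq_of_testBit_eq fun i => ?_⟩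
  rw [Nat.testBit_and, Bool.and_eq_left_iff_imp]
  intro hi
  have hin : i < n := by
    by_contra! hni
    rw [Nat.testBit_lt_two_pow (ha.trans_le (Nat.pow_le_pow_right two_pos hni))] at hi
    exact Bool.false_ne_true hi
  exact mem_bits.1 (h (mem_bits.2 (show a.testBit (⟨i, hin⟩ : Fin n) = true from hi)))

lemma facets_subset (h : L ⊆ L') : facets n L ⊆ facets n L' := fun _ ⟨m, hm, e⟩ => ⟨m, h hm, e⟩

lemma facets_map_mask (f : Fin n → Fin k) :
    facets k (L.map fun m => mask ((bitList n m).map f)) = (fun t => t.image f) '' facets n L := by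
  have h (m : ℕ) : bits k (mask ((bitList n m).map f)) = (bits n m).image f := by
    ext w
    rw [bits_mask]
    simp only [List.mem_toFinset, List.mem_map, mem_bitList, mem_image]
  ext t
  simp only [facets, Set.mem_ofPred_eq, Set.mem_image, List.mem_map]
  constructor
  · rintro ⟨_, ⟨m, hm, rfl⟩, rfl⟩
    exact ⟨_, ⟨m, hm, rfl⟩, (h m).symm⟩
  · rintro ⟨_, ⟨m, hm, rfl⟩, rfl⟩
    exact ⟨_, ⟨m, hm, rfl⟩, h m⟩

end Masks

/-! ### Bistellar moves on bit masks -/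

section Moves

variable {n z A B : ℕ} {L L' : List ℕ}

/-- `bistellarMove` on bit masks; without `List.dedup` the lists would grow exponentially. -/
def move (n A B : ℕ) (L : List ℕ) : List ℕ :=
  (L.filter fun t => A &&& t != A) ++
    ((L.filter fun t => A &&& t == A).flatMap fun t =>
      (bitList n A).map fun u => (t ^^^ 2 ^ u.val) ||| B).dedup

/-- The test for `IsBistellar` on bit masks, together with the condition that neither of the
simplices `A` and `B` is contained in `z`. -/
def movable (n z A B : ℕ) (L : List ℕ) : Bool :=
  A < 2 ^ n && B < 2 ^ n && A &&& B == 0 && A &&& z != A && B &&& z != B &&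
  L.all fun t => B &&& t != B && (A &&& t != A || (bitList n B).all fun w =>
    L.any fun t' => ((t ||| B) ^^^ 2 ^ w.val) &&& t' == (t ||| B) ^^^ 2 ^ w.val)

lemma facets_move (hA : A < 2 ^ n) :
    facets n (move n A B L) = bistellarMove (bits n A) (bits n B) (facets n L) := by
  have hbits {t : ℕ} {u : Fin n} (hAt : bits n A ⊆ bits n t) (hu : u ∈ bits n A) :
      bits n ((t ^^^ 2 ^ u.val) ||| B) = (bits n t).erase u ∪ bits n B := by
    rw [bits_or, bits_xor_two_pow (hAt hu)]
  ext s
  simp only [facets, move, bistellarMove, Set.mem_ofPred_eq, List.mem_append, List.mem_filter,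
    List.mem_dedup, List.mem_flatMap, List.mem_map, mem_bitList, bne_iff_ne, beq_iff_eq, ne_eq,
    and_eq_left_iff_bits_subset hA]
  constructor
  · rintro ⟨m, ⟨hm, hAm⟩ | ⟨t, ⟨ht, hAt⟩, u, hu, rfl⟩, rfl⟩
    · exact Or.inl ⟨⟨m, hm, rfl⟩, hAm⟩
    · exact Or.inr ⟨_, ⟨t, ht, rfl⟩, hAt, u, hu, (hbits hAt hu).symm⟩
  · rintro (⟨⟨m, hm, rfl⟩, hAm⟩ | ⟨_, ⟨t, ht, rfl⟩, hAt, u, hu, rfl⟩)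
    · exact ⟨m, Or.inl ⟨hm, hAm⟩, rfl⟩
    · exact ⟨_, Or.inr ⟨t, ⟨ht, hAt⟩, u, hu, rfl⟩, hbits hAt hu⟩

lemma isBistellar_of_movable (h : movable n z A B L = true) :
    IsBistellar (bits n A) (bits n B) (facets n L) ∧ ¬ bits n A ⊆ bits n z ∧
      ¬ bits n B ⊆ bits n z := by
  simp only [movable, Bool.and_eq_true, decide_eq_true_eq, beq_iff_eq, bne_iff_ne, ne_eq,
    List.all_eq_true, Bool.or_eq_true, List.any_eq_true] at h
  obtain ⟨⟨⟨⟨⟨hA, hB⟩, hAB⟩, hAz⟩, hBz⟩, hL⟩ := h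
  rw [and_eq_left_iff_bits_subset hA] at hAz
  rw [and_eq_left_iff_bits_subset hB] at hBz
  have nonempty {s t : Finset (Fin n)} (hst : ¬ s ⊆ t) : s.Nonempty :=
    nonempty_iff_ne_empty.2 fun he => hst (he ▸ empty_subset t)
  refine ⟨⟨nonempty hAz, nonempty hBz, ?_, ?_, ?_⟩, hAz, hBz⟩
  · rw [disjoint_iff_inter_eq_empty, ← bits_and, hAB]
    simp [bits]
  · rintro _ ⟨t, ht, rfl⟩
    exact (and_eq_left_iff_bits_subset hB).not.1 (hL t ht).1
  · rintro _ ⟨t, ht, rfl⟩ hAt w hw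
    have hAt' := (and_eq_left_iff_bits_subset hA).2 hAt
    obtain ⟨t', ht', hsub⟩ := (hL t ht).2.resolve_left (not_not.2 hAt') w (mem_bitList.2 hw)
    refine ⟨_, ⟨t', ht', rfl⟩, ?_⟩
    rw [← bits_or, ← bits_xor_two_pow (by rw [bits_or]; exact mem_union_right _ hw)]
    exact bits_mono hsub

/-- The value `f a`; the case distinction makes the kernel evaluate `a` to a literal first. -/
def evalNat {α : Type*} (a : ℕ) (f : ℕ → α) : α :=
  match a with
  | 0 => f 0
  | k + 1 => f (k + 1)

/-- The value `f l`; as in `evalNat`, the kernel evaluates the entries of `l` to literals first. -/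
def evalList {α : Type*} : List ℕ → (List ℕ → α) → α
  | [], f => f []
  | a :: l, f => evalNat a fun a' => evalList l fun l' => f (a' :: l')

lemma evalNat_eq {α : Type*} (a : ℕ) (f : ℕ → α) : evalNat a f = f a := by
  cases a <;> rfl

lemma evalList_eq {α : Type*} (l : List ℕ) (f : List ℕ → α) : evalList l f = f l := by
  induction l generalizing f with
  | nil => rfl
  | cons a l ih => rw [evalList, evalNat_eq, ih]

/-- Perform a list of bistellar moves that avoid the simplices with all vertices in `z`; the result
is `none` if one of the moves is not possible. -/
def run (n z : ℕ) : List (ℕ × ℕ) → List ℕ → Option (List ℕ)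
  | [], L => some L
  | (A, B) :: M, L => evalNat A fun A => evalNat B fun B =>
    if movable n z A B L then evalList (move n A B L) (run n z M) else none

lemma exists_homeomorph_move (h : movable n z A B L = true) :
    ∃ e : carrier (facets n L) ≃ₜ carrier (facets n (move n A B L)),
      FixesSupportedIn ↑(bits n z) e := by
  have hA : A < 2 ^ n := by
    simp only [movable, Bool.and_eq_true, decide_eq_true_eq] at h
    exact h.1.1.1.1.1
  obtain ⟨hAB, hAz, hBz⟩ := isBistellar_of_movable h
  rw [facets_move hA]
  exact ⟨hAB.homeomorph, hAB.fixesSupportedIn (coe_subset.not.2 hAz) (coe_subset.not.2 hBz)⟩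

theorem exists_homeomorph_of_run_eq_some {M : List (ℕ × ℕ)} (h : run n z M L = some L') :
    ∃ e : carrier (facets n L) ≃ₜ carrier (facets n L'), FixesSupportedIn ↑(bits n z) e := by
  induction M generalizing L with
  | nil =>
    obtain rfl : L = L' := by simpa [run] using h
    exact ⟨Homeomorph.refl _, fun x _ => rfl, fun y _ => rfl⟩
  | cons m M ih =>
    rw [run, evalNat_eq, evalNat_eq, evalList_eq] at h
    split_ifs at h with hm
    obtain ⟨e, he⟩ := exists_homeomorph_move hm
    obtain ⟨f, hf⟩ := ih h
    exact ⟨e.trans f, he.trans hf⟩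

end Moves

/-! ### Simplicial maps -/

section SimplicialMap

variable {V W : Type*} {π : V → W} {F : Set (Finset V)} {x y : V → ℝ}

lemma linearMap_apply_of_forall_eq [Finite V] [Finite W] {v : V}
    (h : ∀ u, x u ≠ 0 → π u = π v → u = v) :
    FunOnFinite.linearMap ℝ ℝ π x (π v) = x v := by
  classical
  cases nonempty_fintype V
  rw [FunOnFinite.linearMap_apply_apply]
  refine sum_eq_single_of_mem v (by simp) fun u hu huv => ?_
  exact not_not.1 fun hne => huv (h u hne (mem_filter.1 hu).2)

lemma linearMap_apply_of_injOn [Finite V] [Finite W] {t : Set V} (hx : Function.support x ⊆ t)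
    (hπ : Set.InjOn π t) {v : V} (hv : v ∈ t) : FunOnFinite.linearMap ℝ ℝ π x (π v) = x v :=
  linearMap_apply_of_forall_eq fun _ hu huv => hπ (hx hu) hv huv

lemma support_linearMap_subset [Finite V] [Finite W] :
    Function.support (FunOnFinite.linearMap ℝ ℝ π x) ⊆ π '' Function.support x := by
  classical
  cases nonempty_fintype V
  intro w hw
  rw [Function.mem_support, FunOnFinite.linearMap_apply_apply] at hw
  obtain ⟨v, hv, hne⟩ := exists_ne_zero_of_sum_ne_zero hw
  exact ⟨v, hne, (mem_filter.1 hv).2⟩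

lemma carrier_image [Fintype V] [Fintype W] [DecidableEq W] (hπ : ∀ t ∈ F, Set.InjOn π t) :
    carrier ((fun t => t.image π) '' F) = FunOnFinite.linearMap ℝ ℝ π '' carrier F := by
  classical
  ext y
  constructor
  · rintro ⟨⟨h0, h1⟩, _, ⟨t, ht, rfl⟩, hs⟩
    have hx : Function.support (fun v => if v ∈ t then y (π v) else 0) ⊆ t := fun v hv => by
      simp_all
    refine ⟨_, ⟨⟨fun v => ?_, ?_⟩, t, ht, hx⟩, ?_⟩
    · split_ifs
      exacts [h0 _, le_rfl]
    · rw [sum_ite_mem, univ_inter, ← sum_image (f := y) (hπ t ht), ← h1]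
      exact sum_subset (subset_univ _) fun w _ hw => not_not.1 fun hne => hw (hs hne)
    · funext w
      by_cases hw : w ∈ t.image π
      · obtain ⟨v, hv, rfl⟩ := mem_image.1 hw
        rw [linearMap_apply_of_injOn hx (hπ t ht) hv, if_pos hv]
      · rw [not_not.1 fun hne => hw (hs hne)]
        refine not_not.1 fun hne => hw ?_
        obtain ⟨v, hv, rfl⟩ := support_linearMap_subset hne
        exact mem_image_of_mem π (hx hv)
  · rintro ⟨x, ⟨hx, t, ht, hs⟩, rfl⟩
    refine ⟨stdSimplex.image_linearMap π ⟨x, hx, rfl⟩, _, ⟨t, ht, rfl⟩, ?_⟩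
    rw [coe_image]
    exact support_linearMap_subset.trans (Set.image_mono hs)

lemma eq_or_support_subset_of_linearMap_eq [Fintype V] [Finite W] [DecidableEq V] {Z : Set V}
    (hZ : ∀ u ∉ Z, ∀ v, π v = π u → v = u)
    (hstar : ∀ u ∉ Z, ∀ t ∈ F, ∀ t' ∈ F, u ∈ t → u ∈ t' → Set.InjOn π ↑(t ∪ t'))
    (hx : x ∈ carrier F) (hy : y ∈ carrier F)
    (h : FunOnFinite.linearMap ℝ ℝ π x = FunOnFinite.linearMap ℝ ℝ π y) :
    x = y ∨ Function.support x ⊆ Z ∧ Function.support y ⊆ Z := by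
  have hval {u : V} (hu : u ∉ Z) : x u = y u := by
    have hmap (z : V → ℝ) : FunOnFinite.linearMap ℝ ℝ π z (π u) = z u :=
      linearMap_apply_of_forall_eq fun v _ => hZ u hu v
    rw [← hmap x, h, hmap y]
  rw [or_iff_not_imp_right]
  intro hne
  obtain ⟨u, hu, hxu, hyu⟩ : ∃ u ∉ Z, x u ≠ 0 ∧ y u ≠ 0 := by
    rw [not_and_or, Set.not_subset, Set.not_subset] at hne
    obtain ⟨u, hxu, hu⟩ | ⟨u, hyu, hu⟩ := hne
    · exact ⟨u, hu, hxu, hval hu ▸ hxu⟩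
    · exact ⟨u, hu, (hval hu).symm ▸ hyu, hyu⟩
  obtain ⟨-, t, ht, hs⟩ := hx
  obtain ⟨-, t', ht', hs'⟩ := hy
  have hinj := hstar u hu t ht t' ht' (hs hxu) (hs' hyu)
  have hst : Function.support x ⊆ ↑(t ∪ t') := hs.trans (by simp)
  have hst' : Function.support y ⊆ ↑(t ∪ t') := hs'.trans (by simp)
  funext v
  by_cases hv : v ∈ t ∪ t'
  · rw [← linearMap_apply_of_injOn hst hinj hv, h, linearMap_apply_of_injOn hst' hinj hv]
  · rw [not_not.1 fun hne => hv (hst hne), not_not.1 fun hne => hv (hst' hne)]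

lemma nonempty_homeomorph_carrier_image [Fintype V] [Fintype W] [DecidableEq W] {ι : V → W}
    (hι : Function.Injective ι) (F : Set (Finset V)) :
    Nonempty (carrier F ≃ₜ carrier ((fun t => t.image ι) '' F)) := by
  rw [carrier_image fun t _ => hι.injOn]
  have hleft : Function.LeftInverse (fun y v => y (ι v)) (FunOnFinite.linearMap ℝ ℝ ι) :=
    fun x => funext fun v => linearMap_apply_of_injOn (Set.subset_univ _) hι.injOn (Set.mem_univ v)
  have hemb := hleft.isEmbedding (continuous_pi fun v => continuous_apply (ι v))
    (FunOnFinite.continuous_linearMap ℝ ℝ ι)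
  exact ⟨hemb.homeomorphImage _⟩

end SimplicialMap

/-! ### The disc as a cone over a polygon -/

lemma exists_homeomorph_of_isQuotientMap {Q X Y : Type*} [TopologicalSpace Q] [TopologicalSpace X]
    [TopologicalSpace Y] {p : Q → X} {g : Q → Y} (hp : Topology.IsQuotientMap p)
    (hg : Topology.IsQuotientMap g) (h : ∀ q q', p q = p q' ↔ g q = g q') :
    ∃ e : X ≃ₜ Y, ∀ q, e (p q) = g q := by
  have hpg (q : Q) : g (Function.surjInv hp.surjective (p q)) = g q :=
    (h _ _).1 (Function.surjInv_eq _ _)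
  have hgp (q : Q) : p (Function.surjInv hg.surjective (g q)) = p q :=
    (h _ _).2 (Function.surjInv_eq _ _)
  refine ⟨⟨⟨fun x => g (Function.surjInv hp.surjective x),
    fun y => p (Function.surjInv hg.surjective y), fun x => ?_, fun y => ?_⟩, ?_, ?_⟩, hpg⟩
  · exact (hgp _).trans (Function.surjInv_eq _ _)
  · exact (hpg _).trans (Function.surjInv_eq _ _)
  · exact hp.continuous_iff.2 (hg.continuous.congr fun q => (hpg q).symm)
  · exact hg.continuous_iff.2 (hp.continuous.congr fun q => (hgp q).symm)

/-- The point of the unit circle that divides the `j`-th of its `N` equal arcs in the ratio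
`s : 1 - s`. -/
noncomputable def circlePoint (N j : ℕ) (s : ℝ) : ℂ :=
  Complex.exp (2 * Real.pi * Complex.I * ((j + s) / N))

section Circle

variable {N j j' : ℕ} {s s' : ℝ}

lemma norm_circlePoint : ‖circlePoint N j s‖ = 1 := by
  have h : 2 * Real.pi * Complex.I * ((j + s) / N) =
      (2 * Real.pi * ((j + s) / N) : ℝ) * Complex.I := by
    push_cast
    ring
  rw [circlePoint, h, Complex.norm_exp_ofReal_mul_I]

lemma exists_norm_mul_circlePoint_eq (hN : 0 < N) (z : ℂ) :
    ∃ j < N, ∃ s ∈ Set.Icc (0 : ℝ) 1, ‖z‖ * circlePoint N j s = z := by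
  have hN' : (0 : ℝ) < N := Nat.cast_pos.2 hN
  set a := z.arg / (2 * Real.pi) with ha
  have hφ : 0 ≤ N * Int.fract a := by positivity
  refine ⟨⌊N * Int.fract a⌋₊, (Nat.floor_lt hφ).2 (mul_lt_of_lt_one_right hN' (Int.fract_lt_one a)),
    Int.fract (N * Int.fract a), ⟨Int.fract_nonneg _, (Int.fract_lt_one _).le⟩, ?_⟩
  have hdiv : ((⌊N * Int.fract a⌋₊ : ℂ) + Int.fract (N * Int.fract a)) / N = Int.fract a := by
    have hfloor : (⌊N * Int.fract a⌋₊ : ℝ) + Int.fract (N * Int.fract a) = N * Int.fract a := by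
      rw [natCast_floor_eq_intCast_floor hφ, Int.floor_add_fract]
    rw [div_eq_iff (by exact_mod_cast hN.ne')]
    exact_mod_cast hfloor.trans (mul_comm _ _)
  have harg : z.arg = 2 * Real.pi * (Int.fract a + ⌊a⌋) := by
    rw [Int.fract_add_floor, ha]
    field_simp
  conv_rhs => rw [← Complex.norm_mul_exp_arg_mul_I z]
  rw [circlePoint, hdiv, harg]
  congr 1
  rw [Complex.exp_eq_exp_iff_exists_int]
  refine ⟨-⌊a⌋, ?_⟩
  push_cast
  ring

lemma circlePoint_eq_iff_exists_int (hN : 0 < N) : circlePoint N j s = circlePoint N j' s' ↔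
    ∃ n : ℤ, (j + s : ℝ) = j' + s' + N * n := by
  have hN' : (N : ℂ) ≠ 0 := Nat.cast_ne_zero.2 hN.ne'
  rw [circlePoint, circlePoint, Complex.exp_eq_exp_iff_exists_int]
  refine exists_congr fun n => ?_
  have h : 2 * Real.pi * Complex.I * ((j' + s') / N) + n * (2 * Real.pi * Complex.I) =
      2 * Real.pi * Complex.I * ((j' + s' + N * n) / N) := by
    field_simp
  rw [h, mul_right_inj' Complex.two_pi_I_ne_zero, div_left_inj' hN']
  exact_mod_cast Iff.rfl

lemma circlePoint_eq_iff (hN : 0 < N) (hs : s ∈ Set.Icc (0 : ℝ) 1) (hs' : s' ∈ Set.Icc (0 : ℝ) 1) :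
    circlePoint N j s = circlePoint N j' s' ↔ (s = s' ∧ j ≡ j' [MOD N]) ∨
      (s = 0 ∧ s' = 1 ∧ j ≡ j' + 1 [MOD N]) ∨ (s = 1 ∧ s' = 0 ∧ j + 1 ≡ j' [MOD N]) := by
  simp only [circlePoint_eq_iff_exists_int hN, ← Int.natCast_modEq_iff, Int.modEq_iff_add_fac]
  push_cast
  constructor
  · rintro ⟨n, hn⟩
    have hlow : (-1 : ℝ) ≤ (j - j' - N * n : ℤ) := by push_cast; linarith [hs.2, hs'.1]
    have hupp : ((j - j' - N * n : ℤ) : ℝ) ≤ 1 := by push_cast; linarith [hs.1, hs'.2]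
    have hcast : ((j - j' - N * n : ℤ) : ℝ) = s' - s := by push_cast; linarith
    have hlow' : -1 ≤ (j - j' - N * n : ℤ) := by exact_mod_cast hlow
    have hupp' : (j - j' - N * n : ℤ) ≤ 1 := by exact_mod_cast hupp
    obtain h | h | h : (j - j' - N * n : ℤ) = 0 ∨ (j - j' - N * n : ℤ) = 1 ∨
      (j - j' - N * n : ℤ) = -1 := by omega
    all_goals rw [h] at hcast; push_cast at hcast
    · exact Or.inl ⟨by linarith, -n, by linarith⟩
    · exact Or.inr (Or.inl ⟨by linarith [hs.1, hs'.2], by linarith [hs.1, hs'.2], -n, by linarith⟩)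
    · exact Or.inr (Or.inr ⟨by linarith [hs.2, hs'.1], by linarith [hs.2, hs'.1], -n, by linarith⟩)
  · have hcast {a b n : ℤ} (h : a = b + N * n) : (a : ℝ) = b + N * n := by exact_mod_cast h
    rintro (⟨rfl, n, hn⟩ | ⟨rfl, rfl, n, hn⟩ | ⟨rfl, rfl, n, hn⟩) <;>
      · have := hcast hn
        push_cast at this
        exact ⟨-n, by push_cast; linarith⟩

end Circle

section Edge

variable {V : Type*} [DecidableEq V] {a b a' b' : V} {s s' : ℝ}

/-- The point that divides the edge from `a` to `b` in the ratio `s : 1 - s`, in barycentric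
coordinates. -/
def edgePoint (a b : V) (s : ℝ) : V → ℝ := Pi.single a (1 - s) + Pi.single b s

lemma edgePoint_zero : edgePoint a b 0 = Pi.single a 1 := by simp [edgePoint]

lemma edgePoint_one : edgePoint a b 1 = Pi.single b 1 := by simp [edgePoint]

lemma edgePoint_eq_or (hab : a ≠ b) (hab' : a' ≠ b') (h : edgePoint a b s = edgePoint a' b' s') :
    (s = 0 ∧ s' = 0 ∧ a = a') ∨ (s = 0 ∧ s' = 1 ∧ a = b') ∨ (s = 1 ∧ s' = 0 ∧ b = a') ∨
      (s = 1 ∧ s' = 1 ∧ b = b') ∨ (a = a' ∧ b = b' ∧ s = s') ∨ (a = b' ∧ b = a') := by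
  have ha := congrFun h a
  have hb := congrFun h b
  have ha' := congrFun h a'
  have hb' := congrFun h b'
  simp only [edgePoint, Pi.add_apply, Pi.single_apply] at ha hb ha' hb'
  grind

lemma linearMap_edgePoint {W : Type*} [Finite V] [Finite W] [DecidableEq W] (π : V → W) :
    FunOnFinite.linearMap ℝ ℝ π (edgePoint a b s) = edgePoint (π a) (π b) s := by
  rw [edgePoint, map_add, FunOnFinite.linearMap_piSingle, FunOnFinite.linearMap_piSingle, edgePoint]

end Edge

section Wheel

variable {V : Type*} {N : ℕ} {rim : ℕ → V} {apex : V} {j j' : ℕ} {r r' s s' : ℝ}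

/-- The vertices of the cone with the given apex over an `N`-gon, whose vertices are enumerated
periodically by `rim`. -/
structure IsWheel (N : ℕ) (rim : ℕ → V) (apex : V) : Prop where
  three_le : 3 ≤ N
  rim_eq_rim_iff : ∀ {i j}, rim i = rim j ↔ i ≡ j [MOD N]
  rim_ne_apex : ∀ i, rim i ≠ apex

lemma IsWheel.pos (h : IsWheel N rim apex) : 0 < N := by have := h.three_le; omega

lemma IsWheel.rim_ne_rim_succ (h : IsWheel N rim apex) : rim j ≠ rim (j + 1) := by
  have := h.three_le
  rw [Ne, h.rim_eq_rim_iff, Nat.modEq_iff_dvd]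
  rintro hdvd
  have := Int.le_of_dvd (by omega) hdvd
  omega

variable [DecidableEq V]

/-- The facets of the cone with the given apex over the polygon with vertices `rim j`. -/
def wheelFacets (rim : ℕ → V) (apex : V) : Set (Finset V) :=
  Set.range fun j => {apex, rim j, rim (j + 1)}

/-- The point at distance `r` from the apex on the segment from the apex to a point of the
polygon. -/
def wheelPoint (rim : ℕ → V) (apex : V) (j : ℕ) (s r : ℝ) : V → ℝ :=
  Pi.single apex (1 - r) + r • edgePoint (rim j) (rim (j + 1)) s

lemma IsWheel.edgePoint_eq_iff (h : IsWheel N rim apex) (hs : s ∈ Set.Icc (0 : ℝ) 1)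
    (hs' : s' ∈ Set.Icc (0 : ℝ) 1) :
    edgePoint (rim j) (rim (j + 1)) s = edgePoint (rim j') (rim (j' + 1)) s' ↔
      circlePoint N j s = circlePoint N j' s' := by
  rw [circlePoint_eq_iff h.pos hs hs']
  constructor
  · intro heq
    rcases edgePoint_eq_or h.rim_ne_rim_succ h.rim_ne_rim_succ heq with
      ⟨rfl, rfl, e⟩ | ⟨rfl, rfl, e⟩ | ⟨rfl, rfl, e⟩ | ⟨rfl, rfl, e⟩ | ⟨e, -, rfl⟩ | ⟨e, e'⟩
    · exact Or.inl ⟨rfl, h.rim_eq_rim_iff.1 e⟩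
    · exact Or.inr (Or.inl ⟨rfl, rfl, h.rim_eq_rim_iff.1 e⟩)
    · exact Or.inr (Or.inr ⟨rfl, rfl, h.rim_eq_rim_iff.1 e⟩)
    · exact Or.inl ⟨rfl, (h.rim_eq_rim_iff.1 e).add_right_cancel' 1⟩
    · exact Or.inl ⟨rfl, h.rim_eq_rim_iff.1 e⟩
    · have hmod : j' + 2 ≡ j' [MOD N] :=
        ((h.rim_eq_rim_iff.1 e).add_right 1).symm.trans (h.rim_eq_rim_iff.1 e')
      have hle := Nat.le_of_dvd two_pos (Nat.modEq_zero_iff_dvd.1 (hmod.add_left_cancel' j'))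
      have := h.three_le
      omega
  · rintro (⟨rfl, e⟩ | ⟨rfl, rfl, e⟩ | ⟨rfl, rfl, e⟩)
    · rw [h.rim_eq_rim_iff.2 e, h.rim_eq_rim_iff.2 (e.add_right 1)]
    · rw [edgePoint_zero, edgePoint_one, h.rim_eq_rim_iff.2 e]
    · rw [edgePoint_zero, edgePoint_one, h.rim_eq_rim_iff.2 e]

lemma IsWheel.wheelPoint_apply_apex (h : IsWheel N rim apex) :
    wheelPoint rim apex j s r apex = 1 - r := by
  simp [wheelPoint, edgePoint, (h.rim_ne_apex _).symm]

lemma IsWheel.wheelPoint_eq_iff (h : IsWheel N rim apex) (hr : 0 ≤ r) (hr' : 0 ≤ r')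
    (hs : s ∈ Set.Icc (0 : ℝ) 1) (hs' : s' ∈ Set.Icc (0 : ℝ) 1) :
    wheelPoint rim apex j s r = wheelPoint rim apex j' s' r' ↔
      r * circlePoint N j s = r' * circlePoint N j' s' := by
  have hw (heq : wheelPoint rim apex j s r = wheelPoint rim apex j' s' r') : r = r' := by
    have := congrFun heq apex
    rw [h.wheelPoint_apply_apex, h.wheelPoint_apply_apex] at this
    linarith
  have hc (heq : (r : ℂ) * circlePoint N j s = r' * circlePoint N j' s') : r = r' := by
    have := congrArg norm heq
    rwa [norm_mul, norm_mul, norm_circlePoint, norm_circlePoint, Complex.norm_real,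
      Complex.norm_real, Real.norm_of_nonneg hr, Real.norm_of_nonneg hr', mul_one, mul_one] at this
  by_cases hrr : r = r'
  · subst hrr
    rw [wheelPoint, wheelPoint, add_right_inj, mul_eq_mul_left_iff, Complex.ofReal_eq_zero,
      ← h.edgePoint_eq_iff hs hs']
    by_cases hr0 : r = 0
    · simp [hr0]
    · rw [(smul_right_injective _ hr0).eq_iff, or_iff_left hr0]
  · exact iff_of_false (mt hw hrr) (mt hc hrr)

lemma IsWheel.eq_single_add_single_add_single (h : IsWheel N rim apex) {x : V → ℝ}
    (hx : Function.support x ⊆ ↑({apex, rim j, rim (j + 1)} : Finset V)) :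
    x = Pi.single apex (x apex) + (Pi.single (rim j) (x (rim j)) +
      Pi.single (rim (j + 1)) (x (rim (j + 1)))) := by
  funext v
  have hne : rim j ≠ rim (j + 1) := h.rim_ne_rim_succ
  have ha := h.rim_ne_apex j
  have hb := h.rim_ne_apex (j + 1)
  by_cases hv : x v = 0
  · simp only [Pi.add_apply, Pi.single_apply]
    grind
  · have := hx hv
    simp only [coe_insert, coe_singleton, Set.mem_insert_iff, Set.mem_singleton_iff] at this
    simp only [Pi.add_apply, Pi.single_apply]
    grind

variable [Fintype V]

lemma wheelPoint_mem_carrier (hs : s ∈ Set.Icc (0 : ℝ) 1) (hr : r ∈ Set.Icc (0 : ℝ) 1) :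
    wheelPoint rim apex j s r ∈ carrier (wheelFacets rim apex) := by
  refine ⟨⟨fun v => ?_, ?_⟩, _, ⟨j, rfl⟩, fun v hv => ?_⟩
  · have hs0 := hs.1
    have hr0 := hr.1
    have hs1 := sub_nonneg.2 hs.2
    have hr1 := sub_nonneg.2 hr.2
    simp only [wheelPoint, edgePoint, Pi.add_apply, Pi.smul_apply, Pi.single_apply, smul_eq_mul]
    positivity
  · simp only [wheelPoint, edgePoint, Pi.add_apply, Pi.smul_apply, smul_eq_mul, sum_add_distrib,
      ← mul_sum, sum_pi_single', mem_univ, if_true]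
    ring
  · by_contra hcon
    simp only [coe_insert, coe_singleton, Set.mem_insert_iff, Set.mem_singleton_iff,
      not_or] at hcon
    exact hv (by simp [wheelPoint, edgePoint, hcon])

lemma IsWheel.exists_wheelPoint_eq (h : IsWheel N rim apex) {x : V → ℝ}
    (hx : x ∈ carrier (wheelFacets rim apex)) : ∃ j < N, ∃ s ∈ Set.Icc (0 : ℝ) 1,
      ∃ r ∈ Set.Icc (0 : ℝ) 1, wheelPoint rim apex j s r = x := by
  obtain ⟨⟨h0, h1⟩, _, ⟨i, rfl⟩, hs⟩ := hx
  obtain ⟨j, hj, hji⟩ : ∃ j < N, j ≡ i [MOD N] := ⟨i % N, Nat.mod_lt _ h.pos, Nat.mod_modEq _ _⟩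
  simp only [← h.rim_eq_rim_iff.2 hji, ← h.rim_eq_rim_iff.2 (hji.add_right 1)] at hs
  have hx := h.eq_single_add_single_add_single hs
  have hsum : x apex + (x (rim j) + x (rim (j + 1))) = 1 := by
    rw [hx] at h1
    simpa only [Pi.add_apply, sum_add_distrib, sum_pi_single', mem_univ, if_true] using h1
  have ha := h0 apex
  have hb := h0 (rim j)
  have hc := h0 (rim (j + 1))
  set r := x (rim j) + x (rim (j + 1))
  refine ⟨j, hj, x (rim (j + 1)) / r,
    ⟨by positivity, div_le_one_of_le₀ (by linarith) (by linarith)⟩,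
    r, ⟨by positivity, by linarith⟩, ?_⟩
  have hmul : r * (x (rim (j + 1)) / r) = x (rim (j + 1)) :=
    mul_div_cancel_of_imp' fun h => by linarith
  rw [wheelPoint, edgePoint, smul_add, ← Pi.single_smul', ← Pi.single_smul', smul_eq_mul,
    smul_eq_mul, hmul, mul_sub, hmul]
  refine Eq.trans ?_ hx.symm
  congr 3 <;> linarith

theorem IsWheel.exists_homeomorph (h : IsWheel N rim apex) :
    ∃ e : Metric.closedBall (0 : ℂ) 1 ≃ₜ carrier (wheelFacets rim apex),
      ∀ j < N, ∀ s ∈ Set.Icc (0 : ℝ) 1, ∀ r ∈ Set.Icc (0 : ℝ) 1,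
        ∀ z : Metric.closedBall (0 : ℂ) 1, (z : ℂ) = r * circlePoint N j s →
          (e z : V → ℝ) = wheelPoint rim apex j s r := by
  let I := Set.Icc (0 : ℝ) 1
  let p : Fin N × I × I → Metric.closedBall (0 : ℂ) 1 := fun q =>
    ⟨q.2.2 * circlePoint N q.1 q.2.1, by
      rw [mem_closedBall_zero_iff, norm_mul, norm_circlePoint, mul_one, Complex.norm_real,
        Real.norm_of_nonneg q.2.2.2.1]
      exact q.2.2.2.2⟩
  let g : Fin N × I × I → carrier (wheelFacets rim apex) := fun q =>
    ⟨wheelPoint rim apex q.1 q.2.1 q.2.2, wheelPoint_mem_carrier q.2.1.2 q.2.2.2⟩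
  have hp : Continuous p := continuous_prod_of_discrete_left.2 fun j =>
    Continuous.subtype_mk (by unfold circlePoint; fun_prop) _
  have hg : Continuous g := continuous_prod_of_discrete_left.2 fun j =>
    Continuous.subtype_mk (by
      refine continuous_pi fun v => ?_
      simp only [wheelPoint, edgePoint, Pi.add_apply, Pi.smul_apply, Pi.single_apply]
      split_ifs <;> fun_prop) _
  have hps : Function.Surjective p := fun z => by
    obtain ⟨j, hj, s, hs, hz⟩ := exists_norm_mul_circlePoint_eq h.pos (z : ℂ)
    exact ⟨(⟨j, hj⟩, ⟨s, hs⟩, ⟨‖(z : ℂ)‖, norm_nonneg _, mem_closedBall_zero_iff.1 z.2⟩),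
      Subtype.ext hz⟩
  have hgs : Function.Surjective g := by
    rintro ⟨x, hx⟩
    obtain ⟨j, hj, s, hs, r, hr, rfl⟩ := h.exists_wheelPoint_eq hx
    exact ⟨(⟨j, hj⟩, ⟨s, hs⟩, ⟨r, hr⟩), rfl⟩
  obtain ⟨e, he⟩ := exists_homeomorph_of_isQuotientMap (.of_surjective_continuous hps hp)
    (.of_surjective_continuous hgs hg) fun q q' => by
      rw [Subtype.ext_iff, Subtype.ext_iff]
      exact (h.wheelPoint_eq_iff q.2.2.2.1 q'.2.2.2.1 q.2.1.2 q'.2.1.2).symm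
  refine ⟨e, fun j hj s hs r hr z hz => ?_⟩
  obtain rfl : p (⟨j, hj⟩, ⟨s, hs⟩, ⟨r, hr⟩) = z := Subtype.ext hz.symm
  rw [he]

end Wheel

/-! ### Gluing the boundary of a triangulated disc -/

/-- The vertex of the quotient to which the side identifications `a₁a₁a₂a₂⋯` send the `j`-th vertex
of a polygon each of whose sides `aᵢ` is subdivided into three edges. -/
def crosscapVertex (j : ℕ) : ℕ := if j % 3 = 0 then 0 else 2 * (j / 6) + j % 3

section CrosscapVertex

variable {i j j' k : ℕ}

lemma crosscapVertex_ne_succ : crosscapVertex j ≠ crosscapVertex (j + 1) := by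
  unfold crosscapVertex
  split_ifs <;> omega

lemma crosscapVertex_add_three (hi : i ≤ 3) :
    crosscapVertex (6 * k + i) = crosscapVertex (6 * k + i + 3) := by
  grind [crosscapVertex]

lemma mod_three_eq_zero_or_of_crosscapVertex_eq (h : crosscapVertex j = crosscapVertex j') :
    (j % 3 = 0 ∧ j' % 3 = 0) ∨
      (j % 3 ≠ 0 ∧ j' % 3 ≠ 0 ∧ 6 * (j / 6) + j % 3 = 6 * (j' / 6) + j' % 3) := by
  grind [crosscapVertex]

lemma edge_eq_of_crosscapVertex_eq (h : crosscapVertex j = crosscapVertex j')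
    (h' : crosscapVertex (j + 1) = crosscapVertex (j' + 1)) :
    6 * (j / 6) + j % 3 = 6 * (j' / 6) + j' % 3 := by
  grind [crosscapVertex]

lemma crosscapVertex_succ_ne_of_eq_succ (h : crosscapVertex j = crosscapVertex (j' + 1)) :
    crosscapVertex (j + 1) ≠ crosscapVertex j' := by
  unfold crosscapVertex at *
  split_ifs at * <;> omega

end CrosscapVertex

section Boundary

variable {h : ℕ}

lemma crosscapRel_iff {x y : Metric.closedBall (0 : ℂ) 1} : crosscapRel h x y ↔
    ∃ k < h, ∃ i < 3, ∃ s ∈ Set.Icc (0 : ℝ) 1, (x : ℂ) = circlePoint (6 * h) (6 * k + i) s ∧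
      (y : ℂ) = circlePoint (6 * h) (6 * k + i + 3) s := by
  have hexp (k i : ℕ) (s : ℝ) : circlePoint (6 * h) (6 * k + i) s =
      Complex.exp (2 * Real.pi * Complex.I * ((2 * k + ((i + s) / 3 : ℝ)) / (2 * h))) := by
    rw [circlePoint]
    congr 2
    push_cast
    rw [show (6 * h : ℂ) = 3 * (2 * h) by ring, ← div_div]
    congr 1
    ring
  have hexp' (k i : ℕ) (s : ℝ) : circlePoint (6 * h) (6 * k + i + 3) s =
      Complex.exp (2 * Real.pi * Complex.I * ((2 * k + 1 + ((i + s) / 3 : ℝ)) / (2 * h))) := by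
    rw [add_assoc, hexp]
    congr 3
    push_cast
    ring
  simp only [hexp, hexp']
  constructor
  · rintro ⟨k, t, ht, hx, hy⟩
    obtain ⟨i, hi, s, hs, his⟩ : ∃ i < 3, ∃ s ∈ Set.Icc (0 : ℝ) 1, (i : ℕ) + s = 3 * t := by
      rcases ht.2.lt_or_eq with hlt | rfl
      · have h0 : 0 ≤ 3 * t := by linarith [ht.1]
        exact ⟨⌊3 * t⌋₊, (Nat.floor_lt h0).2 (by push_cast; linarith), 3 * t - ⌊3 * t⌋₊,
          ⟨sub_nonneg.2 (Nat.floor_le h0), by linarith [Nat.lt_floor_add_one (3 * t)]⟩, by ring⟩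
      · exact ⟨2, by norm_num, 1, ⟨zero_le_one, le_rfl⟩, by norm_num⟩
    have hist : (i + s) / 3 = t := by linarith
    exact ⟨k, k.2, i, hi, s, hs, by rw [hx, hist], by rw [hy, hist]⟩
  · rintro ⟨k, hk, i, hi, s, hs, hx, hy⟩
    have hi' : (i : ℝ) ≤ 2 := by exact_mod_cast Nat.lt_succ_iff.1 hi
    exact ⟨⟨k, hk⟩, (i + s) / 3, ⟨by linarith [hs.1, i.cast_nonneg (α := ℝ)], by linarith [hs.2]⟩,
      hx, hy⟩

/-- The class in `N_h` of the boundary point of the disc that divides the `j`-th of `6h` equal arcs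
in the ratio `s : 1 - s`. -/
noncomputable def boundaryClass (h j : ℕ) (s : ℝ) : NonorientableSurface h :=
  Quot.mk _ ⟨circlePoint (6 * h) j s, by rw [mem_closedBall_zero_iff, norm_circlePoint]⟩

variable {i j j' k : ℕ} {s s' : ℝ}

lemma boundaryClass_add_three (hk : k < h) (hi : i < 3) (hs : s ∈ Set.Icc (0 : ℝ) 1) :
    boundaryClass h (6 * k + i + 3) s = boundaryClass h (6 * k + i) s :=
  (Quot.sound (crosscapRel_iff.2 ⟨k, hk, i, hi, s, hs, rfl, rfl⟩)).symm

lemma boundaryClass_one : boundaryClass h j 1 = boundaryClass h (j + 1) 0 := by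
  have hc : circlePoint (6 * h) j 1 = circlePoint (6 * h) (j + 1) 0 := by simp [circlePoint]
  exact congrArg (Quot.mk _) (Subtype.ext hc)

lemma boundaryClass_three_mul {m : ℕ} (hm : m ≤ 2 * h) :
    boundaryClass h (3 * m) 0 = boundaryClass h 0 0 := by
  induction m with
  | zero => rfl
  | succ m ih =>
    rw [← ih (by omega)]
    rcases Nat.even_or_odd' m with ⟨k, rfl | rfl⟩
    · have hglue := boundaryClass_add_three (h := h) (k := k) (i := 0) (by omega) (by omega)
        (Set.left_mem_Icc.2 zero_le_one)
      rwa [show 3 * (2 * k + 1) = 6 * k + 0 + 3 by ring, show 3 * (2 * k) = 6 * k + 0 by ring]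
    · have hglue := boundaryClass_add_three (h := h) (k := k) (i := 2) (by omega) (by omega)
        (Set.right_mem_Icc.2 zero_le_one)
      rw [boundaryClass_one, boundaryClass_one] at hglue
      rwa [show 3 * (2 * k + 1 + 1) = 6 * k + 2 + 3 + 1 by ring,
        show 3 * (2 * k + 1) = 6 * k + 2 + 1 by ring]

lemma boundaryClass_edge (hj : j < 6 * h) (hs : s ∈ Set.Icc (0 : ℝ) 1) :
    boundaryClass h j s = boundaryClass h (6 * (j / 6) + j % 3) s := by
  by_cases hlt : j % 6 < 3
  · rw [show 6 * (j / 6) + j % 3 = j by omega]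
  · rw [← boundaryClass_add_three (by omega) (by omega) hs,
      show 6 * (j / 6) + j % 3 + 3 = j by omega]

lemma boundaryClass_eq_of_crosscapVertex_eq (hj : j ≤ 6 * h) (hj' : j' ≤ 6 * h)
    (heq : crosscapVertex j = crosscapVertex j') :
    boundaryClass h j 0 = boundaryClass h j' 0 := by
  rcases mod_three_eq_zero_or_of_crosscapVertex_eq heq with ⟨h3, h3'⟩ | ⟨_, _, hedge⟩
  · rw [← Nat.mul_div_cancel' (Nat.dvd_of_mod_eq_zero h3), boundaryClass_three_mul (by omega),
      ← Nat.mul_div_cancel' (Nat.dvd_of_mod_eq_zero h3'), boundaryClass_three_mul (by omega)]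
  · rw [boundaryClass_edge (by omega) (Set.left_mem_Icc.2 zero_le_one), hedge,
      ← boundaryClass_edge (by omega) (Set.left_mem_Icc.2 zero_le_one)]

end Boundary

section Gluing

variable {V W : Type*} [DecidableEq W] {h : ℕ} {rim : ℕ → V} {π : V → W} {j j' : ℕ} {s s' : ℝ}

/-- On the vertices `rim 0, …, rim (6 h)` of the boundary of the disc, `π` makes exactly the side
identifications `a₁a₁a₂a₂⋯a_ha_h`, each side consisting of three edges. -/
def GluesCrosscaps (h : ℕ) (rim : ℕ → V) (π : V → W) : Prop :=
  ∀ i ≤ 6 * h, ∀ j ≤ 6 * h, π (rim i) = π (rim j) ↔ crosscapVertex i = crosscapVertex j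

lemma GluesCrosscaps.boundaryClass_eq (hπ : GluesCrosscaps h rim π) (hj : j < 6 * h)
    (hj' : j' < 6 * h) (hs : s ∈ Set.Icc (0 : ℝ) 1)
    (heq : edgePoint (π (rim j)) (π (rim (j + 1))) s =
      edgePoint (π (rim j')) (π (rim (j' + 1))) s') :
    boundaryClass h j s = boundaryClass h j' s' := by
  have hne {i : ℕ} (hi : i < 6 * h) : π (rim i) ≠ π (rim (i + 1)) := fun hc =>
    crosscapVertex_ne_succ ((hπ i hi.le (i + 1) hi).1 hc)
  rcases edgePoint_eq_or (hne hj) (hne hj') heq with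
    ⟨rfl, rfl, e⟩ | ⟨rfl, rfl, e⟩ | ⟨rfl, rfl, e⟩ | ⟨rfl, rfl, e⟩ | ⟨e, e', rfl⟩ | ⟨e, e'⟩
  · exact boundaryClass_eq_of_crosscapVertex_eq hj.le hj'.le ((hπ _ hj.le _ hj'.le).1 e)
  · rw [boundaryClass_one]
    exact boundaryClass_eq_of_crosscapVertex_eq hj.le hj' ((hπ _ hj.le _ hj').1 e)
  · rw [boundaryClass_one]
    exact boundaryClass_eq_of_crosscapVertex_eq hj hj'.le ((hπ _ hj _ hj'.le).1 e)
  · rw [boundaryClass_one, boundaryClass_one]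
    exact boundaryClass_eq_of_crosscapVertex_eq hj hj' ((hπ _ hj _ hj').1 e)
  · rw [boundaryClass_edge hj hs, boundaryClass_edge hj' hs,
      edge_eq_of_crosscapVertex_eq ((hπ _ hj.le _ hj'.le).1 e) ((hπ _ hj _ hj').1 e')]
  · exact absurd ((hπ _ hj _ hj'.le).1 e')
      (crosscapVertex_succ_ne_of_eq_succ ((hπ _ hj.le _ hj').1 e))

lemma GluesCrosscaps.edgePoint_eq (hπ : GluesCrosscaps h rim π) {k i : ℕ} (hk : k < h)
    (hi : i < 3) : edgePoint (π (rim (6 * k + i))) (π (rim (6 * k + i + 1))) s =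
      edgePoint (π (rim (6 * k + i + 3))) (π (rim (6 * k + i + 3 + 1))) s := by
  rw [(hπ _ (by omega) _ (by omega)).2 (crosscapVertex_add_three hi.le),
    (hπ (6 * k + i + 1) (by omega) (6 * k + i + 3 + 1) (by omega)).2
      (crosscapVertex_add_three (i := i + 1) hi)]

variable [DecidableEq V] [Fintype V] [Fintype W] {apex : V} {F : Set (Finset V)}

lemma IsWheel.exists_homeomorph_of_fixesSupportedIn {N : ℕ} (hw : IsWheel N rim apex)
    {e : carrier (wheelFacets rim apex) ≃ₜ carrier F} (he : FixesSupportedIn (Set.range rim) e) :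
    ∃ f : Metric.closedBall (0 : ℂ) 1 ≃ₜ carrier F,
      (∀ j < N, ∀ s ∈ Set.Icc (0 : ℝ) 1, ∀ z : Metric.closedBall (0 : ℂ) 1,
        (z : ℂ) = circlePoint N j s → (f z : V → ℝ) = edgePoint (rim j) (rim (j + 1)) s) ∧
      ∀ z, Function.support (f z : V → ℝ) ⊆ Set.range rim → ‖(z : ℂ)‖ = 1 := by
  obtain ⟨f, hf⟩ := hw.exists_homeomorph
  refine ⟨f.trans e, fun j hj s hs z hz => ?_, fun z hz => ?_⟩
  · have hfz := hf j hj s hs 1 ⟨zero_le_one, le_rfl⟩ z (by simpa using hz)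
    rw [wheelPoint, sub_self, Pi.single_zero, zero_add, one_smul] at hfz
    rw [← hfz]
    refine he.1 (f z) fun v hv => ?_
    by_contra hcon
    refine hv ?_
    have h1 : v ≠ rim j := fun h => hcon ⟨j, h.symm⟩
    have h2 : v ≠ rim (j + 1) := fun h => hcon ⟨j + 1, h.symm⟩
    simp [hfz, edgePoint, h1, h2]
  · obtain ⟨j, hj, s, hs, hzj⟩ := exists_norm_mul_circlePoint_eq hw.pos (z : ℂ)
    have hfz := hf j hj s hs ‖(z : ℂ)‖ ⟨norm_nonneg _, mem_closedBall_zero_iff.1 z.2⟩ z hzj.symm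
    have hez : (f z : V → ℝ) = (e (f z)).1 := by
      rw [← he.2 (e (f z)) hz, e.symm_apply_apply]
    have happ : wheelPoint rim apex j s ‖(z : ℂ)‖ apex = 0 := by
      rw [← hfz, hez]
      exact not_not.1 fun hne => (hz hne).elim fun i hi => hw.rim_ne_apex i hi
    rw [hw.wheelPoint_apply_apex] at happ
    linarith

theorem nonempty_homeomorph_nonorientableSurface (hw : IsWheel (6 * h) rim apex)
    {e : carrier (wheelFacets rim apex) ≃ₜ carrier F} (he : FixesSupportedIn (Set.range rim) e)
    (hfacet : ∀ t ∈ F, Set.InjOn π t) (hglue : GluesCrosscaps h rim π)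
    (hZ : ∀ u ∉ Set.range rim, ∀ v, π v = π u → v = u)
    (hstar : ∀ u ∉ Set.range rim, ∀ t ∈ F, ∀ t' ∈ F, u ∈ t → u ∈ t' → Set.InjOn π ↑(t ∪ t')) :
    Nonempty (carrier ((fun t => t.image π) '' F) ≃ₜ NonorientableSurface h) := by
  obtain ⟨f, hedge, hnorm⟩ := hw.exists_homeomorph_of_fixesSupportedIn he
  rw [carrier_image hfacet]
  let g : Metric.closedBall (0 : ℂ) 1 → FunOnFinite.linearMap ℝ ℝ π '' carrier F :=
    fun z => ⟨_, Set.mem_image_of_mem _ (f z).2⟩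
  have hg : Continuous g := Continuous.subtype_mk
    ((FunOnFinite.continuous_linearMap ℝ ℝ π).comp (continuous_subtype_val.comp f.continuous)) _
  have hgs : Function.Surjective g := by
    rintro ⟨_, x, hx, rfl⟩
    exact ⟨f.symm ⟨x, hx⟩, by simp only [g, f.apply_symm_apply]⟩
  have hgc {j : ℕ} (hj : j < 6 * h) {s : ℝ} (hs : s ∈ Set.Icc (0 : ℝ) 1)
      {z : Metric.closedBall (0 : ℂ) 1} (hz : (z : ℂ) = circlePoint (6 * h) j s) :
      (g z : W → ℝ) = edgePoint (π (rim j)) (π (rim (j + 1))) s := by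
    simp only [g, hedge j hj s hs z hz, linearMap_edgePoint]
  have hcircle {z : Metric.closedBall (0 : ℂ) 1}
      (hz : Function.support (f z : V → ℝ) ⊆ Set.range rim) :
      ∃ j < 6 * h, ∃ s ∈ Set.Icc (0 : ℝ) 1, (z : ℂ) = circlePoint (6 * h) j s := by
    obtain ⟨j, hj, s, hs, hzj⟩ := exists_norm_mul_circlePoint_eq hw.pos (z : ℂ)
    rw [hnorm z hz, Complex.ofReal_one, one_mul] at hzj
    exact ⟨j, hj, s, hs, hzj.symm⟩
  have : CompactSpace (Metric.closedBall (0 : ℂ) 1) :=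
    isCompact_iff_compactSpace.1 (isCompact_closedBall 0 1)
  refine ⟨(exists_homeomorph_of_isQuotientMap (.of_surjective_continuous hgs hg)
    (isQuotientMap_quot_mk (r := crosscapRel h)) fun z z' => ⟨fun hzz => ?_, fun hzz => ?_⟩).choose⟩
  · rcases eq_or_support_subset_of_linearMap_eq hZ hstar (f z).2 (f z').2
      (congrArg Subtype.val hzz) with heq | ⟨hz, hz'⟩
    · rw [f.injective (Subtype.ext heq)]
    · obtain ⟨j, hj, s, hs, hzj⟩ := hcircle hz
      obtain ⟨j', hj', s', hs', hzj'⟩ := hcircle hz'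
      have hclass := hglue.boundaryClass_eq hj hj' hs
        (by rw [← hgc hj hs hzj, hzz, hgc hj' hs' hzj'])
      exact (congrArg (Quot.mk _) (Subtype.ext hzj)).trans
        (hclass.trans (congrArg (Quot.mk _) (Subtype.ext hzj'.symm)))
  · refine congrArg (Quot.lift g fun x y hxy => Subtype.ext ?_) hzz
    obtain ⟨k, hk, i, hi, s, hs, hx, hy⟩ := crosscapRel_iff.1 hxy
    rw [hgc (by omega) hs hx, hgc (by omega) hs hy, hglue.edgePoint_eq hk hi]

end Gluing

/-! ### Complexes generated by facets and their symmetries -/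

section Facets

variable {V W : Type*}

/-- The simplicial complex generated by a family of facets that cover the vertices. -/
def ofFacets (F : Set (Finset V)) (hF : ∀ v, ∃ t ∈ F, v ∈ t) : AbstractSimplicialComplex V where
  faces := {s | s.Nonempty ∧ ∃ t ∈ F, s ⊆ t}
  isRelLowerSet_faces := fun {_} ⟨hs, t, ht, hst⟩ =>
    ⟨hs, fun _ hus hu => ⟨hu, t, ht, hus.trans hst⟩⟩
  singleton_mem v := by
    obtain ⟨t, ht, hv⟩ := hF v
    exact ⟨singleton_nonempty v, t, ht, singleton_subset_iff.2 hv⟩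

variable {F : Set (Finset V)} {hF : ∀ v, ∃ t ∈ F, v ∈ t} {G : Set (Finset W)}
  {hG : ∀ w, ∃ t ∈ G, w ∈ t} {s : Finset V} {σ : V ≃ W} {k : ℕ}

lemma mem_faces_ofFacets : s ∈ (ofFacets F hF).faces ↔ s.Nonempty ∧ ∃ t ∈ F, s ⊆ t := Iff.rfl

lemma space_ofFacets [Fintype V] : space (ofFacets F hF) = carrier F := by
  classical
  ext x
  constructor
  · rintro ⟨h0, h1, s, ⟨-, t, ht, hst⟩, hs⟩
    exact ⟨⟨h0, h1⟩, t, ht, fun v hv => hst ((hs v).2 hv)⟩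
  · rintro ⟨⟨h0, h1⟩, t, ht, hs⟩
    refine ⟨h0, h1, univ.filter fun v => x v ≠ 0, ⟨?_, t, ht, fun v hv => ?_⟩, fun v => by simp⟩
    · obtain ⟨v, -, hv⟩ := exists_ne_zero_of_sum_ne_zero (h1.trans_ne one_ne_zero)
      exact ⟨v, by simpa using hv⟩
    · exact hs (mem_filter.1 hv).2

lemma mem_faces_ofFacets_and_card_eq (hk : k ≠ 0) (hFk : ∀ t ∈ F, #t = k) :
    s ∈ (ofFacets F hF).faces ∧ #s = k ↔ s ∈ F := by
  refine ⟨?_, fun hs => ⟨⟨card_ne_zero.1 (hFk s hs ▸ hk), s, hs, Subset.rfl⟩, hFk s hs⟩⟩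
  rintro ⟨⟨-, t, ht, hst⟩, hs⟩
  rwa [eq_of_subset_of_card_le hst (hFk t ht ▸ hs.ge)]

lemma isIso_ofFacets (hσ : (fun t => t.map σ.toEmbedding) '' F = G) :
    IsIso (ofFacets F hF) (ofFacets G hG) σ := by
  subst hσ
  simp [IsIso, mem_faces_ofFacets]

lemma IsIso.image_facets_eq (hσ : IsIso (ofFacets F hF) (ofFacets G hG) σ) (hk : k ≠ 0)
    (hFk : ∀ t ∈ F, #t = k) (hGk : ∀ t ∈ G, #t = k) :
    (fun t => t.map σ.toEmbedding) '' F = G := by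
  have hmem (s : Finset V) : s.map σ.toEmbedding ∈ G ↔ s ∈ F := by
    rw [← mem_faces_ofFacets_and_card_eq (hF := hG) hk hGk, card_map, ← hσ,
      mem_faces_ofFacets_and_card_eq hk hFk]
  ext t
  refine ⟨?_, fun ht => ?_⟩
  · rintro ⟨s, hs, rfl⟩
    exact (hmem s).2 hs
  · have hst : (t.map σ.symm.toEmbedding).map σ.toEmbedding = t := by simp [map_map]
    exact ⟨_, (hmem _).1 (hst.symm ▸ ht), hst⟩

end Facets

section Symmetry

variable {V W : Type*} {Δ : AbstractSimplicialComplex V} {Γ : AbstractSimplicialComplex W}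
  {σ : V ≃ W}

lemma IsIso.symm (hσ : IsIso Δ Γ σ) : IsIso Γ Δ σ.symm := fun s => by
  rw [hσ, map_map, ← Equiv.trans_toEmbedding, Equiv.symm_trans_self, Equiv.refl_toEmbedding,
    map_refl]

variable [Fintype V] [Fintype W]

lemma IsIso.comp_mem_space (hσ : IsIso Δ Γ σ) {x : W → ℝ} (hx : x ∈ space Γ) :
    x ∘ σ ∈ space Δ := by
  obtain ⟨h0, h1, s, hs, hsx⟩ := hx
  refine ⟨fun v => h0 _, (σ.sum_comp x).trans h1, s.map σ.symm.toEmbedding, (hσ.symm s).1 hs,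
    fun v => ?_⟩
  simp [← hsx]

lemma isGeometricSymmetry_of_linear {ψ : V → E3} {R : E3 ≃ₗᵢ[ℝ] E3} {σ : V ≃ V}
    (hσ : IsIso Δ Δ σ) (hR : ∀ v, R (ψ v) = ψ (σ v)) :
    IsGeometricSymmetry Δ ψ R.toAffineIsometryEquiv := by
  refine ⟨?_, σ, hσ, hR⟩
  let E : space Δ → space Δ := fun x => ⟨x.1 ∘ σ.symm, hσ.symm.comp_mem_space x.2⟩
  have hE : Function.Surjective E := fun x =>
    ⟨⟨x.1 ∘ σ, hσ.comp_mem_space x.2⟩, Subtype.ext (by simp [E, Function.comp_def])⟩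
  have hRE : R ∘ simplexwiseLinear Δ ψ = simplexwiseLinear Δ ψ ∘ E := funext fun x => by
    simp only [Function.comp_apply, simplexwiseLinear, E, map_sum, map_smul, hR]
    rw [← σ.sum_comp fun v => x.1 (σ.symm v) • ψ v]
    simp only [Equiv.symm_apply_apply]
  rw [← Set.range_comp]
  exact (congrArg Set.range hRE).trans (hE.range_comp _)

end Symmetry

section Rotation

/-- The rotation of space that permutes the coordinates cyclically. -/
noncomputable def cyclicIsometry : E3 ≃ₗᵢ[ℝ] E3 :=
  LinearIsometryEquiv.piLpCongrLeft 2 ℝ ℝ (finRotate 3)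

lemma cyclicIsometry_apply (x : E3) (k : Fin 3) :
    cyclicIsometry x k = x ((finRotate 3).symm k) := rfl

lemma cyclicIsometry_cubed (x : E3) : cyclicIsometry (cyclicIsometry (cyclicIsometry x)) = x := by
  have h : ∀ k, (finRotate 3).symm ((finRotate 3).symm ((finRotate 3).symm k)) = k := by decide
  ext k
  rw [cyclicIsometry_apply, cyclicIsometry_apply, cyclicIsometry_apply, h]

lemma isThreefoldRotation_cyclicIsometry :
    IsThreefoldRotation cyclicIsometry.toAffineIsometryEquiv := by
  constructor
  · have h : LinearMap.det (cyclicIsometry.toLinearEquiv : E3 →ₗ[ℝ] E3) ^ 3 = 1 := by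
      rw [← map_pow, ← map_one (LinearMap.det : (E3 →ₗ[ℝ] E3) →* ℝ)]
      exact congrArg _ (LinearMap.ext cyclicIsometry_cubed)
    exact (Odd.strictMono_pow (by decide : Odd 3)).injective (h.trans (one_pow 3).symm)
  · refine orderOf_eq_prime (AffineIsometryEquiv.ext cyclicIsometry_cubed) fun h => ?_
    have h1 : cyclicIsometry (EuclideanSpace.single 0 1) 1 = (EuclideanSpace.single 0 1 : E3) 1 :=
      congrArg (fun R : E3 ≃ᵃⁱ[ℝ] E3 => R (EuclideanSpace.single 0 1) 1) h
    rw [cyclicIsometry_apply, show (finRotate 3).symm 1 = 0 by decide] at h1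
    simp at h1

end Rotation

/-! ### An invariant of triangulated surfaces -/

section Invariant

variable {V W : Type*} [DecidableEq V] [DecidableEq W]

/-- The sum, over the ordered pairs of adjacent triangles whose common edge can be flipped, of the
products of the degrees of the four vertices. -/
def flipInvariant (T : Finset (Finset V)) : ℕ :=
  ∑ t ∈ T, ∑ u ∈ T, if #(t ∩ u) = 2 ∧ ∀ r ∈ T, ¬ symmDiff t u ⊆ r then
    ∏ w ∈ t ∪ u, #{r ∈ T | w ∈ r} else 0

lemma flipInvariant_map (σ : V ≃ W) (T : Finset (Finset V)) :
    flipInvariant (T.map (mapEmbedding σ.toEmbedding).toEmbedding) = flipInvariant T := by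
  have hdeg (w : V) : #{r ∈ T.map (mapEmbedding σ.toEmbedding).toEmbedding | σ w ∈ r} =
      #{r ∈ T | w ∈ r} := by
    rw [filter_map, card_map]
    simp [Function.comp_def]
  have hflip (t u r : Finset V) : symmDiff (t.map σ.toEmbedding) (u.map σ.toEmbedding) ⊆
      r.map σ.toEmbedding ↔ symmDiff t u ⊆ r := by
    rw [map_eq_image, map_eq_image, ← image_symmDiff _ _ σ.toEmbedding.injective, ← map_eq_image,
      map_subset_map]
  simp only [flipInvariant, sum_map, RelEmbedding.coe_toEmbedding, mapEmbedding_apply, ← map_inter,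
    ← map_union, card_map, forall_mem_map, hflip, prod_map, Equiv.coe_toEmbedding, hdeg]

/-- `flipInvariant` for a list of triangles, in a form that evaluates quickly. -/
def flipInvariantList (L : List (Finset V)) : ℕ :=
  (L.map fun t => (L.map fun u => if #(t ∩ u) = 2 ∧ ∀ r ∈ L, ¬ symmDiff t u ⊆ r then
    ∏ w ∈ t ∪ u, L.countP (fun r => w ∈ r) else 0).sum).sum

lemma flipInvariant_toFinset {L : List (Finset V)} (hL : L.Nodup) :
    flipInvariant L.toFinset = flipInvariantList L := by
  have hdeg (w : V) : #{r ∈ L.toFinset | w ∈ r} = L.countP (fun r => w ∈ r) := by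
    rw [List.countP_eq_length_filter, ← List.toFinset_card_of_nodup (hL.filter _),
      List.toFinset_filter]
    simp only [decide_eq_true_eq]
  simp only [flipInvariant, flipInvariantList, List.sum_toFinset _ hL, hdeg, List.mem_toFinset]

end Invariant

/-! ### Simplexwise linear immersions -/

section Minors

variable {n : ℕ} {R : Type*} [CommRing R]

/-- The maximal minors of a matrix with one row more than columns, with alternating signs. By
Cramer's rule every linear relation between the rows is proportional to them. -/
def signedMinor (A : Matrix (Fin (n + 1)) (Fin n) R) (i : Fin (n + 1)) : R :=
  (-1) ^ (i : ℕ) * (A.submatrix i.succAbove id).det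

variable {A : Matrix (Fin (n + 1)) (Fin n) R} {x : Fin (n + 1) → R}

lemma mul_signedMinor_comm (h : Matrix.vecMul x A = 0) (i j : Fin (n + 1)) :
    x i * signedMinor A j = x j * signedMinor A i := by
  let B : Matrix (Fin (n + 1)) (Fin (n + 1)) R :=
    Matrix.of fun k => Fin.cons (Pi.single (M := fun _ => R) j 1 k) (A k)
  have hminor (k : Fin (n + 1)) : B.submatrix k.succAbove Fin.succ = A.submatrix k.succAbove id :=
    rfl
  have hdet : B.det = signedMinor A j := by
    rw [Matrix.det_succ_column_zero, Fintype.sum_eq_single j]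
    · simp [hminor, signedMinor, B]
    · intro k hk
      simp [B, hk]
  have hadj : B.adjugate 0 i = signedMinor A i := by
    rw [Matrix.adjugate_fin_succ_eq_det_submatrix]
    simp [hminor, signedMinor]
  have hxB : Matrix.vecMul x B = Pi.single 0 (x j) := by
    refine funext <| Fin.cases ?_ fun k => ?_
    · simp [Matrix.vecMul, dotProduct, B, Pi.single_apply]
    · exact congrFun h k
  have hmul := congrFun (congrArg (Matrix.vecMul · B.adjugate) hxB) i
  simpa [Matrix.vecMul_vecMul, Matrix.mul_adjugate, Matrix.vecMul_smul, hdet, hadj, mul_comm]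
    using hmul

lemma eq_zero_of_vecMul_eq_zero_of_signs [LinearOrder R] [IsStrictOrderedRing R]
    (h : Matrix.vecMul x A = 0) {ε : Fin (n + 1) → R} (hx : ∀ i, 0 ≤ ε i * x i)
    (hpos : ∃ i, 0 < ε i * signedMinor A i) (hneg : ∃ j, ε j * signedMinor A j < 0) : x = 0 := by
  obtain ⟨i, hi⟩ := hpos
  obtain ⟨j, hj⟩ := hneg
  have hij : ε j * x j * (ε i * signedMinor A i) = ε i * x i * (ε j * signedMinor A j) := by
    linear_combination ε i * ε j * mul_signedMinor_comm h j i
  have hεx : ε j * x j = 0 := by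
    refine (hx j).antisymm' (nonpos_of_mul_nonpos_left ?_ hi)
    exact hij.trans_le (mul_nonpos_of_nonneg_of_nonpos (hx i) hj.le)
  have hxj : x j = 0 := (mul_eq_zero.1 hεx).resolve_left (left_ne_zero_of_mul hj.ne)
  funext k
  have hk := mul_signedMinor_comm h k j
  rw [hxj, zero_mul] at hk
  exact (mul_eq_zero.1 hk).resolve_right (right_ne_zero_of_mul hj.ne)

end Minors

section AffineRelations

variable {V : Type*} {n k : ℕ} {R : Type*} [CommRing R]

/-- The matrix whose rows are the edge vectors from the vertex `v` to the vertices `p i`. -/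
def edgeMatrix (ψ : V → Fin n → R) (v : V) (p : Fin k → V) : Matrix (Fin k) (Fin n) R :=
  Matrix.of fun i => ψ (p i) - ψ v

variable [Fintype V]

/-- The affine relations between the points `ψ w`. -/
def IsAffineRelation (ψ : V → Fin n → R) (z : V → R) : Prop :=
  ∑ w, z w = 0 ∧ ∑ w, z w • ψ w = 0

variable {ψ : V → Fin n → R} {z : V → R} {v : V} {p : Fin k → V}

lemma IsAffineRelation.vecMul_edgeMatrix (hz : IsAffineRelation ψ z) (hp : p.Injective)
    (hsupp : ∀ w, z w ≠ 0 → w = v ∨ w ∈ Set.range p) :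
    Matrix.vecMul (z ∘ p) (edgeMatrix ψ v p) = 0 := by
  have hsum : ∑ i, z (p i) • (ψ (p i) - ψ v) = ∑ w, z w • (ψ w - ψ v) := by
    refine Fintype.sum_of_injective p hp _ _ (fun w hw => ?_) fun _ => rfl
    by_cases hzw : z w = 0
    · rw [hzw, zero_smul]
    · rw [(hsupp w hzw).resolve_right hw, sub_self, smul_zero]
  rw [Matrix.vecMul_eq_sum]
  refine hsum.trans ?_
  simp only [smul_sub, sum_sub_distrib, ← sum_smul, hz.1, hz.2, zero_smul, sub_zero]

lemma IsAffineRelation.eq_zero_of_comp_eq_zero (hz : IsAffineRelation ψ z)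
    (hsupp : ∀ w, z w ≠ 0 → w = v ∨ w ∈ Set.range p) (hzp : z ∘ p = 0) : z = 0 := by
  have hne (w : V) (hw : w ≠ v) : z w = 0 := by
    by_contra hzw
    obtain ⟨i, rfl⟩ := (hsupp w hzw).resolve_left hw
    exact hzw (congrFun hzp i)
  funext w
  by_cases hw : w = v
  · rw [hw, ← Fintype.sum_eq_single v hne, hz.1, Pi.zero_apply]
  · exact hne w hw

lemma IsAffineRelation.eq_zero_of_det_ne_zero [IsDomain R] {p : Fin n → V}
    (hz : IsAffineRelation ψ z) (hdet : (edgeMatrix ψ v p).det ≠ 0)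
    (hsupp : ∀ w, z w ≠ 0 → w = v ∨ w ∈ Set.range p) : z = 0 := by
  have hp : p.Injective := fun i j hij => by
    by_contra hne
    exact hdet (Matrix.det_zero_of_row_eq hne (congrArg (ψ · - ψ v) hij))
  exact hz.eq_zero_of_comp_eq_zero hsupp
    (Matrix.eq_zero_of_vecMul_eq_zero hdet (hz.vecMul_edgeMatrix hp hsupp))

lemma IsAffineRelation.eq_zero_of_signs [LinearOrder R] [IsStrictOrderedRing R]
    {p : Fin (n + 1) → V} (hz : IsAffineRelation ψ z) (hp : p.Injective)
    (hsupp : ∀ w, z w ≠ 0 → w = v ∨ w ∈ Set.range p) {ε : Fin (n + 1) → R}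
    (hε : ∀ i, 0 ≤ ε i * z (p i)) (hpos : ∃ i, 0 < ε i * signedMinor (edgeMatrix ψ v p) i)
    (hneg : ∃ j, ε j * signedMinor (edgeMatrix ψ v p) j < 0) : z = 0 :=
  hz.eq_zero_of_comp_eq_zero hsupp
    (eq_zero_of_vecMul_eq_zero_of_signs (hz.vecMul_edgeMatrix hp hsupp) hε hpos hneg)

end AffineRelations

lemma isImmersion_of_injOn_star {V : Type*} [Fintype V] {Δ : AbstractSimplicialComplex V}
    {ψ : V → E3} (h : ∀ v, Set.InjOn (simplexwiseLinear Δ ψ) {x | x.1 v ≠ 0}) :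
    IsImmersion Δ ψ := by
  intro x
  obtain ⟨v, -, hv⟩ := exists_ne_zero_of_sum_ne_zero (x.2.2.1.trans_ne one_ne_zero)
  exact ⟨{y | y.1 v ≠ 0},
    isOpen_ne_fun ((continuous_apply v).comp continuous_subtype_val) continuous_const, hv, h v⟩

section LatticePoints

variable {V : Type*}

/-- The points of space with the given integer coordinates. -/
noncomputable def latticePoint (a : Fin 3 → ℤ) : E3 := WithLp.toLp 2 fun k => (a k : ℝ)

/-- The determinant of three integer vectors, in a form that evaluates quickly. -/
def tripleDet (a b c : Fin 3 → ℤ) : ℤ :=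
  a 0 * (b 1 * c 2 - b 2 * c 1) - a 1 * (b 0 * c 2 - b 2 * c 0) + a 2 * (b 0 * c 1 - b 1 * c 0)

/-- The coefficients of a linear relation `x₀ a + x₁ b = x₂ c + x₃ d` between four vectors in
general position. -/
def relationCoeffs (a b c d : Fin 3 → ℤ) : Fin 4 → ℤ :=
  ![tripleDet b c d, -tripleDet a c d, -tripleDet a b d, tripleDet a b c]

/-- A criterion for the cones at `v` over the edges `pq` and `rs` to meet in a common face only:
either the four edge vectors at `v` are among three linearly independent ones, or they are distinct
and the only linear relation between the two pairs has coefficients of both signs. -/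
def StarCompatible (ψ : V → Fin 3 → ℤ) (v p q r s : V) : Prop :=
  ([v, p, q, r, s].Nodup ∧
    (∃ i, 0 < relationCoeffs (ψ p - ψ v) (ψ q - ψ v) (ψ r - ψ v) (ψ s - ψ v) i) ∧
    ∃ j, relationCoeffs (ψ p - ψ v) (ψ q - ψ v) (ψ r - ψ v) (ψ s - ψ v) j < 0) ∨
  ∃ u, r ∈ [p, q, u] ∧ s ∈ [p, q, u] ∧ tripleDet (ψ p - ψ v) (ψ q - ψ v) (ψ u - ψ v) ≠ 0

instance [Fintype V] [DecidableEq V] (ψ : V → Fin 3 → ℤ) (v p q r s : V) :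
    Decidable (StarCompatible ψ v p q r s) :=
  inferInstanceAs (Decidable (_ ∨ _))

section Cast

variable {R : Type*} [CommRing R] (ψ : V → Fin 3 → ℤ) (v p q r s u : V)

lemma det_edgeMatrix_intCast :
    (edgeMatrix (fun w k => (ψ w k : R)) v ![p, q, u]).det =
      tripleDet (ψ p - ψ v) (ψ q - ψ v) (ψ u - ψ v) := by
  simp [Matrix.det_fin_three, edgeMatrix, tripleDet]
  ring

lemma signs_mul_signedMinor_intCast (i : Fin 4) :
    ![1, 1, -1, -1] i * signedMinor (edgeMatrix (fun w k => (ψ w k : R)) v ![p, q, r, s]) i =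
      relationCoeffs (ψ p - ψ v) (ψ q - ψ v) (ψ r - ψ v) (ψ s - ψ v) i := by
  fin_cases i <;>
    simp [signedMinor, edgeMatrix, relationCoeffs, tripleDet, Matrix.det_fin_three,
      Fin.succAbove, Fin.lt_def] <;> ring

end Cast

variable [Fintype V] {Δ : AbstractSimplicialComplex V} {ψ : V → Fin 3 → ℤ}

lemma isAffineRelation_sub {x y : space Δ}
    (h : simplexwiseLinear Δ (fun w => latticePoint (ψ w)) x =
      simplexwiseLinear Δ (fun w => latticePoint (ψ w)) y) :
    IsAffineRelation (fun w k => (ψ w k : ℝ)) (x.1 - y.1) := by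
  constructor
  · simp [x.2.2.1, y.2.2.1]
  · ext k
    have hk := congrArg (fun a : E3 => a k) h
    simpa [simplexwiseLinear, latticePoint, sub_mul, sub_eq_zero] using hk

lemma IsAffineRelation.eq_zero_of_starCompatible {z : V → ℝ}
    (hz : IsAffineRelation (fun w k => (ψ w k : ℝ)) z) {v p q r s : V}
    (h : StarCompatible ψ v p q r s) (hsupp : ∀ w, z w ≠ 0 → w ∈ [v, p, q, r, s])
    (hnonneg : ∀ w ∉ [v, r, s], 0 ≤ z w) (hnonpos : ∀ w ∉ [v, p, q], z w ≤ 0) : z = 0 := by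
  obtain ⟨hd, ⟨i, hi⟩, j, hj⟩ | ⟨u, hr, hs, hu⟩ := h
  · have hp : Function.Injective ![p, q, r, s] := List.nodup_ofFn.1 hd.tail
    have hmem (w : V) (hw : w ∈ [v, p, q, r, s]) : w = v ∨ w ∈ Set.range ![p, q, r, s] :=
      (List.mem_cons.1 hw).imp_right List.mem_ofFn.1
    have hsign (i : Fin 4) : 0 ≤ ![1, 1, -1, -1] i * z (![p, q, r, s] i) := by
      fin_cases i
      · simpa using hnonneg p (by grind)
      · simpa using hnonneg q (by grind)
      · simpa using hnonpos r (by grind)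
      · simpa using hnonpos s (by grind)
    refine hz.eq_zero_of_signs hp (fun w hw => hmem w (hsupp w hw)) hsign ⟨i, ?_⟩ ⟨j, ?_⟩
    · exact (Int.cast_pos.2 hi).trans_eq (signs_mul_signedMinor_intCast ..).symm
    · exact (signs_mul_signedMinor_intCast ..).trans_lt (Int.cast_lt_zero.2 hj)
  · have hmem (w : V) (hw : w ∈ [v, p, q, r, s]) : w = v ∨ w ∈ Set.range ![p, q, u] := by
      have hw' : w ∈ [v, p, q, u] := by grind
      exact (List.mem_cons.1 hw').imp_right List.mem_ofFn.1
    refine hz.eq_zero_of_det_ne_zero (v := v) (p := ![p, q, u]) ?_ fun w hw => hmem w (hsupp w hw)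
    rw [det_edgeMatrix_intCast]
    exact Int.cast_ne_zero.2 hu

theorem isImmersion_of_starCompatible {F : Set (Finset V)} {hF : ∀ v, ∃ t ∈ F, v ∈ t}
    [DecidableEq V]
    (h : ∀ v, ∀ t ∈ F, ∀ t' ∈ F, v ∈ t → v ∈ t' →
      ∃ p q r s, t = {v, p, q} ∧ t' = {v, r, s} ∧ StarCompatible ψ v p q r s) :
    IsImmersion (ofFacets F hF) fun v => latticePoint (ψ v) := by
  refine isImmersion_of_injOn_star fun v x hx y hy hxy => ?_
  obtain ⟨-, t, ht, hxt⟩ := (space_ofFacets (hF := hF)).le x.2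
  obtain ⟨-, t', ht', hyt'⟩ := (space_ofFacets (hF := hF)).le y.2
  obtain ⟨p, q, r, s, rfl, rfl, hcomp⟩ := h v t ht t' ht' (hxt hx) (hyt' hy)
  replace hxt (w : V) (hw : w ∉ [v, p, q]) : x.1 w = 0 := by
    by_contra hne
    simpa using hw (by simpa using hxt hne)
  replace hyt' (w : V) (hw : w ∉ [v, r, s]) : y.1 w = 0 := by
    by_contra hne
    simpa using hw (by simpa using hyt' hne)
  refine Subtype.ext <| sub_eq_zero.1 <| (isAffineRelation_sub hxy).eq_zero_of_starCompatible
    hcomp (fun w => ?_) (fun w hw => ?_) fun w hw => ?_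
  · contrapose!
    intro hw
    simp only [List.mem_cons, not_or] at hw
    simp [hxt w (by simp [hw]), hyt' w (by simp [hw])]
  · simpa [hyt' w hw] using x.2.1 w
  · simpa [hxt w hw] using y.2.1 w

end LatticePoints

/-! ### A triangulation of the surface of genus five with 42 vertices -/

section Hub

/-- The vertices of a 30-gon, indexed cyclically. -/
def rim (j : ℕ) : Fin 61 := Fin.ofNat 61 (j % 30)

/-- The triangulation of the 30-gon as a cone with apex `60`. -/
def coneMasks : List ℕ := (List.range 30).map fun j => mask [60, rim j, rim (j + 1)]

/-- The subdivisions of the 30 spokes of the cone by the vertices `30, …, 59`, which make the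
neighbourhood of the rim fine enough for the identification of its sides. -/
def spokeMoves : List (ℕ × ℕ) := (List.range 30).map fun j => (mask [rim j, 60], 2 ^ (30 + j))

/-- The triangulated 30-gon with subdivided spokes. -/
def discMasks : List ℕ := (run 61 (2 ^ 30 - 1) spokeMoves coneMasks).getD []

/-- The identification `a₁a₁a₂a₂⋯a₅a₅` of the sides of the 30-gon on the vertices. -/
def glue (v : Fin 61) : Fin 42 := Fin.ofNat 42 (if v.val < 30 then crosscapVertex v else v - 19)

/-- The triangles of the glued 30-gon. -/
def hubMasks : List ℕ := discMasks.map fun m => mask ((bitList 61 m).map glue)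

set_option maxRecDepth 10000 in
lemma run_spokeMoves : run 61 (2 ^ 30 - 1) spokeMoves coneMasks = some discMasks := by
  decide +kernel

lemma isWheel_rim : IsWheel 30 rim 60 where
  three_le := by norm_num
  rim_eq_rim_iff := by
    intro i j
    simp only [rim, Fin.ext_iff, Fin.val_ofNat, Nat.ModEq]
    omega
  rim_ne_apex i := by
    simp only [rim, Fin.ne_iff_vne, Fin.val_ofNat]
    change _ ≠ 60
    omega

lemma mem_range_rim {v : Fin 61} : v ∈ Set.range rim ↔ v.val < 30 := by
  refine ⟨?_, fun hv => ⟨v, ?_⟩⟩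
  · rintro ⟨j, rfl⟩
    simp only [rim, Fin.val_ofNat]
    omega
  · simp only [rim, Fin.ext_iff, Fin.val_ofNat]
    omega

lemma coe_bits_rim : (bits 61 (2 ^ 30 - 1) : Set (Fin 61)) = Set.range rim := by
  ext v
  rw [mem_range_rim, mem_coe, mem_bits, Nat.testBit_two_pow_sub_one, decide_eq_true_iff]

lemma facets_coneMasks : facets 61 coneMasks = wheelFacets rim 60 := by
  have hrim (j : ℕ) : rim (j % 30) = rim j := isWheel_rim.rim_eq_rim_iff.2 (Nat.mod_modEq j 30)
  have hrim_succ (j : ℕ) : rim (j % 30 + 1) = rim (j + 1) :=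
    isWheel_rim.rim_eq_rim_iff.2 ((Nat.mod_modEq j 30).add_right 1)
  ext t
  constructor
  · rintro ⟨m, hm, rfl⟩
    obtain ⟨j, -, rfl⟩ := List.mem_map.1 hm
    exact ⟨j, by simp [bits_mask]⟩
  · rintro ⟨j, rfl⟩
    refine ⟨_, List.mem_map.2 ⟨j % 30, List.mem_range.2 (Nat.mod_lt _ (by norm_num)), rfl⟩, ?_⟩
    simp [bits_mask, hrim, hrim_succ]

set_option maxRecDepth 10000 in
lemma gluesCrosscaps_glue : GluesCrosscaps 5 rim glue := by
  unfold GluesCrosscaps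
  decide +kernel

lemma eq_of_glue_eq : ∀ u : Fin 61, ¬ u.val < 30 → ∀ v, glue v = glue u → v = u := by
  decide +kernel

lemma exists_mem_bits_of_mem_discMasks :
    ∀ m ∈ discMasks, ∃ u ∈ bits 61 m, ¬ u.val < 30 := by
  decide +kernel

lemma nodup_map_glue_of_mem_discMasks : ∀ m ∈ discMasks, ∀ m' ∈ discMasks,
    2 ^ 30 ≤ m &&& m' → ((bitList 61 (m ||| m')).map glue).Nodup := by
  decide +kernel

lemma injOn_glue_of_mem_bits {u : Fin 61} (hu : ¬ u.val < 30) :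
    ∀ t ∈ facets 61 discMasks, ∀ t' ∈ facets 61 discMasks, u ∈ t → u ∈ t' →
      Set.InjOn glue ↑(t ∪ t') := by
  rintro _ ⟨m, hm, rfl⟩ _ ⟨m', hm', rfl⟩ hut hut'
  have hle : 2 ^ 30 ≤ m &&& m' := by
    refine (Nat.pow_le_pow_right two_pos (not_lt.1 hu)).trans (Nat.ge_two_pow_of_testBit ?_)
    rw [Nat.testBit_and, mem_bits.1 hut, mem_bits.1 hut', Bool.and_true]
  rw [← bits_or]
  intro v hv w hw h
  exact List.inj_on_of_nodup_map (nodup_map_glue_of_mem_discMasks m hm m' hm' hle)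
    (mem_bitList.2 hv) (mem_bitList.2 hw) h

theorem nonempty_homeomorph_hub :
    Nonempty (carrier (facets 42 hubMasks) ≃ₜ NonorientableSurface 5) := by
  have hinj (t) (ht : t ∈ facets 61 discMasks) : Set.InjOn glue t := by
    obtain ⟨m, hm, rfl⟩ := id ht
    obtain ⟨u, hut, hu⟩ := exists_mem_bits_of_mem_discMasks m hm
    simpa using injOn_glue_of_mem_bits hu _ ht _ ht hut hut
  have hrun := exists_homeomorph_of_run_eq_some run_spokeMoves
  rw [facets_coneMasks, coe_bits_rim] at hrun
  obtain ⟨e, he⟩ := hrun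
  rw [hubMasks, facets_map_mask]
  exact nonempty_homeomorph_nonorientableSurface isWheel_rim he hinj gluesCrosscaps_glue
    (fun u hu => eq_of_glue_eq u (mt mem_range_rim.2 hu))
    fun u hu => injOn_glue_of_mem_bits (mt mem_range_rim.2 hu)

end Hub

/-! ### Ten triangulations with ten vertices -/

/-- Bistellar moves `(A, B)` that reduce the triangulation `hubMasks` with 42 vertices to one with
ten vertices, found by a computer search. -/
def reductions : List (List (Fin 42) × List (Fin 42)) := [
  ([0, 26], [5, 25]), ([26, 27], [5, 41]), ([26], [5, 25, 41]), ([0, 20], [3, 19]),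
  ([11, 40], [10, 41]), ([40], [10, 39, 41]), ([27, 41], [5, 28]), ([27], [5, 6, 28]),
  ([39, 41], [10, 38]), ([39], [9, 10, 38]), ([35, 41], [34, 36]), ([33, 41], [32, 34]),
  ([0, 29], [7, 28]), ([3, 20], [19, 21]), ([20], [19, 21, 41]), ([8, 33], [7, 34]),
  ([33], [7, 32, 34]), ([0, 35], [9, 34]), ([35], [9, 34, 36]), ([29, 30], [7, 41]),
  ([29], [7, 28, 41]), ([30, 41], [7, 31]), ([30], [7, 8, 31]), ([13, 14], [0, 41]),
  ([0, 11], [1, 10]), ([1, 14], [0, 15]), ([14], [0, 15, 41]), ([0, 22], [4, 23]),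
  ([0, 16], [2, 17]), ([22, 23], [4, 41]), ([22], [4, 21, 41]), ([19, 21], [3, 41]),
  ([21], [3, 4, 41]), ([12, 13], [2, 41]), ([13], [0, 2, 41]), ([0, 8], [31, 34]),
  ([8], [7, 31, 34]), ([16, 41], [15, 17]), ([16], [2, 15, 17]), ([1, 11], [10, 12]),
  ([11], [10, 12, 41]), ([2, 12], [1, 41]), ([12], [1, 10, 41]), ([36, 41], [34, 37]),
  ([36, 37], [10, 34]), ([36], [9, 10, 34]), ([9, 10], [34, 38]), ([9], [0, 34, 38]),
  ([0, 17], [2, 3]), ([28, 41], [5, 7]), ([0, 1], [10, 15]), ([4, 19], [0, 18]), ([1, 41], [2, 10]),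
  ([1], [2, 10, 15]), ([5, 28], [6, 7]), ([28], [0, 6, 7]), ([4, 41], [3, 23]), ([3, 4], [18, 23]),
  ([4], [0, 18, 23]), ([2, 17], [3, 15]), ([17, 41], [15, 18]), ([17], [3, 15, 18]),
  ([7, 41], [5, 31]), ([5, 23], [0, 24]), ([24, 25], [6, 41]), ([0, 6], [7, 25]), ([0, 3], [2, 19]),
  ([6, 25], [7, 41]), ([18, 41], [15, 19]), ([5, 6], [7, 24]), ([6], [7, 24, 41]),
  ([18, 23], [0, 3]), ([0, 23], [3, 24]), ([23], [3, 24, 41]), ([0, 10], [15, 37]),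
  ([10, 37], [15, 34]), ([0, 19], [2, 18]), ([5, 41], [25, 31]), ([25, 31], [5, 41]),
  ([0, 24], [3, 5]), ([5, 24], [3, 7]), ([24], [3, 7, 41]), ([10, 41], [2, 38]),
  ([2, 10], [15, 38]), ([10], [15, 34, 38]), ([7, 41], [3, 25]), ([2, 18], [0, 19]),
  ([0, 3], [5, 18]), ([3, 25], [7, 41]), ([34, 41], [32, 37]), ([0, 5], [18, 25]),
  ([0, 25], [7, 18]), ([7, 25], [18, 41]), ([25], [5, 18, 41]), ([5, 41], [18, 31]),
  ([5, 18], [3, 31]), ([5], [3, 7, 31]), ([15, 38], [2, 34]), ([38, 41], [2, 37]),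
  ([34, 37], [15, 32]), ([2, 38], [34, 37]), ([38], [0, 34, 37]), ([37, 41], [2, 32]),
  ([3, 41], [7, 19]), ([3, 15], [2, 18]), ([3, 7], [19, 31]), ([3, 19], [2, 31]),
  ([3], [2, 18, 31]), ([0, 34], [31, 37]), ([2, 18], [15, 31]), ([32, 34], [7, 15]),
  ([15, 34], [2, 7]), ([2, 34], [7, 37]), ([34], [7, 31, 37])]

/-- The triangulation with ten vertices that results from `reductions`. -/
def reducedTriangles : List (List (Fin 42)) := [
  [0, 7, 32], [31, 32, 41], [0, 31, 32], [0, 15, 41], [0, 2, 41], [15, 19, 41], [15, 18, 19],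
  [0, 15, 37], [0, 18, 19], [0, 2, 19], [0, 7, 18], [7, 18, 41], [18, 31, 41], [15, 32, 37],
  [2, 32, 41], [2, 32, 37], [7, 19, 41], [7, 19, 31], [2, 19, 31], [0, 31, 37], [15, 18, 31],
  [2, 15, 31], [7, 15, 32], [2, 7, 15], [2, 7, 37], [7, 31, 37]]

/-- The permutation of the ten vertices that is induced by the 3-fold rotation. -/
def rotation : Equiv.Perm (Fin 10) where
  toFun := ![0, 2, 3, 1, 5, 6, 4, 8, 9, 7]
  invFun := ![0, 3, 1, 2, 6, 4, 5, 9, 7, 8]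
  left_inv := by decide
  right_inv := by decide

/-- A triangulated surface with vertices `0, …, 9` that is invariant under `rotation`, with
coordinates of the vertices `0` (on the axis) and `1`, `4`, `7`, and with flips that lead to it from
`reducedTriangles`, the vertices being relabelled by `labels`. -/
structure SymmetricSurface where
  /-- Representatives of the orbits of triangles other than `123` and `456`. -/
  representatives : List (Fin 10 × Fin 10 × Fin 10)
  /-- The coordinates of the vertex `0` are all equal to this integer. -/
  apex : ℤ
  /-- The rows are the coordinates of the vertices `1`, `4`, `7`. -/
  base : Matrix (Fin 3) (Fin 3) ℤ
  /-- The relabelling of the vertices. -/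
  labels : Fin 10 → Fin 42
  /-- The flips: `(a, b, c, d)` replaces the edge `ab` by the edge `cd`. -/
  flips : List (Fin 42 × Fin 42 × Fin 42 × Fin 42)

/-- The data of the ten surfaces, found by a computer search. -/
def surfaces : Fin 10 → SymmetricSurface := ![
  { representatives := [
      (1, 2, 4), (0, 1, 4), (0, 1, 7), (0, 4, 8), (1, 5, 6), (1, 5, 8), (1, 7, 8), (4, 7, 8)]
    apex := -5
    base := !![-1, -3, 13; 1, -2, -2; 2, -1, 3]
    labels := ![15, 32, 31, 41, 7, 18, 0, 37, 2, 19]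
    flips := [
      (0, 19, 2, 18), (7, 31, 19, 37), (0, 32, 7, 31), (2, 41, 0, 32), (0, 2, 18, 32),
      (7, 19, 37, 41), (31, 37, 0, 19)] },
  { representatives := [
      (1, 2, 4), (0, 1, 4), (0, 1, 7), (0, 4, 8), (1, 6, 8), (1, 5, 7), (1, 5, 8), (4, 5, 8)]
    apex := -3
    base := !![9, 1, 0; 3, 2, -2; 5, 1, 1]
    labels := ![15, 32, 31, 41, 7, 18, 0, 37, 2, 19]
    flips := [
      (7, 31, 19, 37), (0, 32, 7, 31), (2, 41, 0, 32), (7, 19, 37, 41), (7, 41, 18, 37),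
      (7, 37, 2, 18), (0, 31, 7, 37), (2, 19, 0, 31), (2, 37, 18, 32), (31, 37, 7, 19),
      (19, 37, 7, 41)] },
  { representatives := [
      (1, 2, 4), (0, 1, 4), (0, 1, 7), (0, 4, 8), (1, 6, 8), (1, 7, 8), (4, 5, 8), (4, 7, 9)]
    apex := 3
    base := !![-4, 3, -9; -3, 0, 1; -5, -1, -3]
    labels := ![15, 32, 31, 41, 7, 18, 0, 37, 2, 19]
    flips := [
      (7, 31, 19, 37), (0, 32, 7, 31), (2, 41, 0, 32), (7, 19, 37, 41), (7, 41, 18, 37),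
      (7, 37, 2, 18), (0, 31, 7, 37), (31, 37, 7, 19)] },
  { representatives := [
      (1, 2, 4), (0, 1, 4), (0, 1, 7), (0, 4, 8), (1, 6, 9), (1, 5, 7), (1, 5, 9), (4, 5, 7)]
    apex := 1
    base := !![0, -4, 3; 8, 1, 3; 2, 4, 2]
    labels := ![0, 19, 7, 15, 18, 31, 41, 2, 32, 37]
    flips := [
      (7, 31, 19, 37), (0, 32, 7, 31), (7, 19, 37, 41), (7, 41, 18, 37), (15, 31, 2, 18),
      (7, 32, 15, 31), (2, 37, 7, 32), (2, 32, 7, 41), (7, 37, 18, 32), (7, 18, 0, 32),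
      (2, 15, 7, 18), (15, 18, 7, 19), (32, 37, 15, 18)] },
  { representatives := [
      (1, 2, 4), (1, 4, 7), (1, 6, 8), (0, 1, 7), (0, 1, 5), (0, 4, 8), (1, 5, 8), (4, 5, 9)]
    apex := 6
    base := !![-1, -2, 0; -3, -3, 2; 4, 2, -5]
    labels := ![15, 32, 41, 31, 18, 7, 0, 37, 19, 2]
    flips := [
      (7, 31, 19, 37), (0, 32, 7, 31), (7, 19, 37, 41), (7, 41, 18, 37), (7, 37, 2, 18),
      (0, 31, 7, 37), (2, 19, 0, 31), (2, 37, 18, 32), (31, 37, 7, 19), (7, 31, 19, 32),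
      (18, 41, 31, 37), (2, 32, 18, 41), (19, 31, 0, 32), (19, 37, 7, 41), (37, 41, 7, 31)] },
  { representatives := [
      (1, 2, 4), (1, 4, 7), (1, 6, 8), (0, 1, 7), (0, 1, 9), (1, 8, 9), (4, 5, 8), (4, 8, 9)]
    apex := 2
    base := !![-3, 2, 11; 3, -5, -3; 0, -2, 1]
    labels := ![0, 19, 15, 37, 18, 32, 41, 7, 31, 2]
    flips := [
      (0, 15, 37, 41), (7, 32, 0, 15), (2, 37, 7, 32), (0, 41, 2, 37), (15, 31, 2, 18),
      (0, 32, 15, 31), (15, 41, 19, 37), (31, 41, 18, 32), (7, 19, 31, 41), (0, 18, 7, 19)] },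
  { representatives := [
      (1, 2, 7), (0, 1, 7), (0, 1, 4), (0, 4, 9), (1, 4, 8), (1, 5, 8), (1, 5, 9), (4, 5, 7)]
    apex := -10
    base := !![5, -3, 2; 0, -1, -3; 2, 4, -6]
    labels := ![15, 0, 19, 32, 37, 41, 31, 2, 18, 7]
    flips := [
      (0, 7, 18, 32), (0, 18, 19, 32), (2, 32, 37, 41), (7, 15, 2, 32), (7, 32, 2, 18),
      (2, 7, 18, 37), (31, 37, 0, 7), (0, 31, 7, 32), (7, 37, 0, 18), (32, 41, 31, 37),
      (31, 32, 7, 37), (2, 15, 31, 32), (0, 41, 2, 15), (7, 18, 0, 41), (32, 37, 7, 15),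
      (2, 18, 32, 37)] },
  { representatives := [
      (1, 2, 7), (0, 1, 7), (0, 1, 4), (0, 4, 9), (1, 4, 8), (1, 6, 8), (1, 6, 9), (4, 5, 8)]
    apex := -5
    base := !![-3, -15, 1; -3, 4, -1; 6, -2, -3]
    labels := ![15, 0, 7, 18, 41, 32, 31, 37, 2, 19]
    flips := [
      (7, 31, 19, 37), (0, 32, 7, 31), (7, 19, 37, 41), (7, 41, 18, 37), (7, 37, 2, 18),
      (0, 31, 7, 37), (2, 19, 0, 31), (2, 37, 18, 32), (31, 37, 7, 19), (7, 31, 19, 32),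
      (18, 41, 31, 37), (19, 37, 7, 41)] },
  { representatives := [
      (1, 2, 7), (0, 1, 7), (0, 1, 4), (0, 4, 9), (1, 4, 8), (1, 8, 9), (4, 5, 7), (4, 7, 8)]
    apex := -2
    base := !![1, -3, 4; 0, -1, 0; 3, -2, 0]
    labels := ![15, 32, 18, 41, 0, 7, 19, 31, 37, 2]
    flips := [
      (15, 31, 2, 18), (31, 41, 18, 32), (7, 19, 31, 41), (0, 18, 7, 19), (7, 31, 37, 41),
      (0, 32, 7, 31), (7, 32, 15, 31), (7, 41, 18, 37), (7, 18, 19, 37), (2, 15, 7, 18),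
      (0, 41, 2, 15), (15, 37, 0, 32), (18, 19, 15, 37)] },
  { representatives := [
      (1, 2, 7), (1, 4, 7), (0, 1, 4), (0, 1, 6), (1, 6, 8), (1, 8, 9), (4, 5, 8), (4, 8, 9)]
    apex := -3
    base := !![6, -2, -1; -3, 17, -2; 3, 3, 1]
    labels := ![15, 32, 18, 41, 7, 19, 0, 31, 37, 2]
    flips := [
      (15, 31, 2, 18), (31, 41, 18, 32), (7, 19, 31, 41), (0, 18, 7, 19), (7, 31, 37, 41),
      (0, 32, 7, 31), (7, 41, 18, 37), (7, 18, 19, 37), (2, 15, 7, 18), (15, 37, 0, 32)] }]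

section Surfaces

variable (S : SymmetricSurface)

/-- The triangles of a symmetric surface. -/
def SymmetricSurface.triangles : List (Fin 10 × Fin 10 × Fin 10) :=
  (1, 2, 3) :: (4, 5, 6) :: S.representatives.flatMap fun (a, b, c) =>
    [(a, b, c), (rotation a, rotation b, rotation c),
      (rotation.symm a, rotation.symm b, rotation.symm c)]

/-- The bit masks of the triangles. -/
def SymmetricSurface.masks : List ℕ := S.triangles.map fun (a, b, c) => mask [a, b, c]

/-- The flips as bistellar moves on bit masks. -/
def SymmetricSurface.flipMasks : List (ℕ × ℕ) :=
  S.flips.map fun (a, b, c, d) => (mask [a, b], mask [c, d])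

/-- The bit masks of the relabelled triangles. -/
def SymmetricSurface.labelledMasks : List ℕ :=
  S.masks.map fun m => mask ((bitList 10 m).map S.labels)

/-- The edges opposite to a vertex in the triangles that contain it. -/
def SymmetricSurface.link (v : Fin 10) : List (Fin 10 × Fin 10) :=
  ((S.triangles.flatMap fun (a, b, c) => [(a, b, c), (b, c, a), (c, a, b)]).filter (·.1 = v)).map
    Prod.snd

/-- The coordinates of the vertices. -/
def SymmetricSurface.coordinates : Fin 10 → Fin 3 → ℤ :=
  ![fun _ => S.apex,
    S.base 0, ![S.base 0 2, S.base 0 0, S.base 0 1], ![S.base 0 1, S.base 0 2, S.base 0 0],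
    S.base 1, ![S.base 1 2, S.base 1 0, S.base 1 1], ![S.base 1 1, S.base 1 2, S.base 1 0],
    S.base 2, ![S.base 2 2, S.base 2 0, S.base 2 1], ![S.base 2 1, S.base 2 2, S.base 2 0]]

end Surfaces

set_option maxRecDepth 10000 in
lemma run_reductions : run 42 0 (reductions.map (Prod.map mask mask)) hubMasks =
    some (reducedTriangles.map mask) := by
  decide +kernel

lemma exists_run_flipMasks : ∀ i,
    ∃ K ∈ run 42 0 (surfaces i).flipMasks (reducedTriangles.map mask),
      K ⊆ (surfaces i).labelledMasks ∧ (surfaces i).labelledMasks ⊆ K := by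
  decide +kernel

lemma labels_injective : ∀ i, Function.Injective (surfaces i).labels := by
  decide +kernel

lemma map_rotation_masks : ∀ i,
    ((surfaces i).masks.map fun m => mask ((bitList 10 m).map rotation)) ⊆ (surfaces i).masks ∧
      (surfaces i).masks ⊆ (surfaces i).masks.map fun m => mask ((bitList 10 m).map rotation) := by
  decide +kernel

lemma card_bits_of_mem_masks : ∀ i, ∀ m ∈ (surfaces i).masks, #(bits 10 m) = 3 := by
  decide +kernel

lemma exists_mem_bits_of_masks : ∀ i v, ∃ m ∈ (surfaces i).masks, v ∈ bits 10 m := by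
  decide +kernel

lemma nodup_map_bits_masks : ∀ i, ((surfaces i).masks.map (bits 10)).Nodup := by
  decide +kernel

lemma starCompatible_of_mem_link : ∀ i v, ∀ e ∈ (surfaces i).link v, ∀ e' ∈ (surfaces i).link v,
    StarCompatible (surfaces i).coordinates v e.1 e.2 e'.1 e'.2 := by
  decide +kernel

theorem nonempty_homeomorph_surface (i : Fin 10) :
    Nonempty (carrier (facets 10 (surfaces i).masks) ≃ₜ NonorientableSurface 5) := by
  obtain ⟨K, hK, hKL, hLK⟩ := exists_run_flipMasks i
  obtain ⟨e₁⟩ := nonempty_homeomorph_carrier_image (labels_injective i)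
    (facets 10 (surfaces i).masks)
  rw [← facets_map_mask, ← SymmetricSurface.labelledMasks,
    (facets_subset hLK).antisymm (facets_subset hKL)] at e₁
  obtain ⟨e₂, -⟩ := exists_homeomorph_of_run_eq_some hK
  obtain ⟨e₃, -⟩ := exists_homeomorph_of_run_eq_some run_reductions
  obtain ⟨e₄⟩ := nonempty_homeomorph_hub
  exact ⟨e₁.trans (e₂.symm.trans (e₃.symm.trans e₄))⟩

lemma exists_mem_facets (i v : Fin 10) : ∃ t ∈ facets 10 (surfaces i).masks, v ∈ t := by
  obtain ⟨m, hm, hv⟩ := exists_mem_bits_of_masks i v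
  exact ⟨_, ⟨m, hm, rfl⟩, hv⟩

lemma card_of_mem_facets (i : Fin 10) : ∀ t ∈ facets 10 (surfaces i).masks, #t = 3 := by
  rintro _ ⟨m, hm, rfl⟩
  exact card_bits_of_mem_masks i m hm

/-- The ten triangulations. -/
def surfaceComplex (i : Fin 10) : AbstractSimplicialComplex (Fin 10) :=
  ofFacets (facets 10 (surfaces i).masks) (exists_mem_facets i)

theorem isTriangulationOf_surfaceComplex (i : Fin 10) :
    IsTriangulationOf (surfaceComplex i) (NonorientableSurface 5) := by
  refine ⟨?_, ?_, ?_⟩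
  · rintro s ⟨-, t, ht, hst⟩
    exact (card_le_card hst).trans (card_of_mem_facets i t ht).le
  · obtain ⟨t, ht, -⟩ := exists_mem_facets i 0
    exact ⟨t, (mem_faces_ofFacets_and_card_eq three_ne_zero (card_of_mem_facets i)).2 ht⟩
  · rw [surfaceComplex, space_ofFacets]
    exact nonempty_homeomorph_surface i

lemma isIso_rotation (i : Fin 10) : IsIso (surfaceComplex i) (surfaceComplex i) rotation := by
  refine isIso_ofFacets ?_
  obtain ⟨hle, hge⟩ := map_rotation_masks i
  simp only [map_eq_image]
  exact (facets_map_mask rotation).symm.trans ((facets_subset hle).antisymm (facets_subset hge))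

/-- The values of `flipInvariant` on the ten triangulations. -/
def flipInvariantValue : Fin 10 → ℕ :=
  ![59136, 36288, 78288, 38880, 64800, 39648, 61824, 86016, 47628, 36864]

lemma flipInvariantList_surfaces :
    ∀ i, flipInvariantList ((surfaces i).masks.map (bits 10)) = flipInvariantValue i := by
  decide +kernel

lemma flipInvariantValue_injective : Function.Injective flipInvariantValue := by
  decide

lemma coe_toFinset_map_bits (i : Fin 10) :
    (((surfaces i).masks.map (bits 10)).toFinset : Set (Finset (Fin 10))) =
      facets 10 (surfaces i).masks := by
  ext t
  simp only [List.coe_toFinset, List.mem_map, Set.mem_ofPred_eq, facets]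

theorem not_isIso_surfaceComplex {i j : Fin 10} (hij : i ≠ j) (σ : Fin 10 ≃ Fin 10) :
    ¬ IsIso (surfaceComplex i) (surfaceComplex j) σ := by
  intro hσ
  have hmap : ((surfaces i).masks.map (bits 10)).toFinset.map
      (mapEmbedding σ.toEmbedding).toEmbedding = ((surfaces j).masks.map (bits 10)).toFinset := by
    rw [← coe_inj, coe_map, coe_toFinset_map_bits, coe_toFinset_map_bits]
    exact hσ.image_facets_eq three_ne_zero (card_of_mem_facets i) (card_of_mem_facets j)
  have hval := congrArg flipInvariant hmap
  rw [flipInvariant_map, flipInvariant_toFinset (nodup_map_bits_masks i),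
    flipInvariant_toFinset (nodup_map_bits_masks j), flipInvariantList_surfaces,
    flipInvariantList_surfaces] at hval
  exact hij (flipInvariantValue_injective hval)

lemma exists_mem_link {S : SymmetricSurface} {t : Finset (Fin 10)} (ht : t ∈ facets 10 S.masks)
    {v : Fin 10} (hv : v ∈ t) : ∃ e ∈ S.link v, t = {v, e.1, e.2} := by
  obtain ⟨m, hm, rfl⟩ := ht
  obtain ⟨⟨a, b, c⟩, hT, rfl⟩ := List.mem_map.1 hm
  have hlink (p q : Fin 10) (h : (v, p, q) ∈ [(a, b, c), (b, c, a), (c, a, b)]) :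
      (p, q) ∈ S.link v := by
    refine List.mem_map.2 ⟨(v, p, q), ?_, rfl⟩
    rw [List.mem_filter, decide_eq_true_iff]
    exact ⟨List.mem_flatMap.2 ⟨_, hT, h⟩, rfl⟩
  rw [bits_mask] at hv ⊢
  simp only [List.mem_toFinset, List.mem_cons, List.not_mem_nil, or_false] at hv
  obtain rfl | rfl | rfl := hv
  · exact ⟨(b, c), hlink b c (by simp), by simp⟩
  · exact ⟨(c, a), hlink c a (by simp), by ext; simp; tauto⟩
  · exact ⟨(a, b), hlink a b (by simp), by ext; simp; tauto⟩

theorem isImmersion_surfaceComplex (i : Fin 10) :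
    IsImmersion (surfaceComplex i) fun v => latticePoint ((surfaces i).coordinates v) := by
  refine isImmersion_of_starCompatible fun v t ht t' ht' hv hv' => ?_
  obtain ⟨e, he, rfl⟩ := exists_mem_link ht hv
  obtain ⟨e', he', rfl⟩ := exists_mem_link ht' hv'
  exact ⟨_, _, _, _, rfl, rfl, starCompatible_of_mem_link i v e he e' he'⟩

lemma cyclicIsometry_coordinates (S : SymmetricSurface) (v : Fin 10) :
    cyclicIsometry (latticePoint (S.coordinates v)) =
      latticePoint (S.coordinates (rotation v)) := by
  ext k
  rw [cyclicIsometry_apply]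
  fin_cases v <;> fin_cases k <;> rfl

theorem isGeometricSymmetry_surfaceComplex (i : Fin 10) :
    IsGeometricSymmetry (surfaceComplex i) (fun v => latticePoint ((surfaces i).coordinates v))
      cyclicIsometry.toAffineIsometryEquiv :=
  isGeometricSymmetry_of_linear (isIso_rotation i) (cyclicIsometry_coordinates _)

end PolyhedralSurface

open PolyhedralSurface in
theorem theorem6 :
    ∃ Δ : Fin 10 → AbstractSimplicialComplex (Fin 10),
      (∀ i, IsTriangulationOf (Δ i) (NonorientableSurface 5)) ∧
      (∀ i j, i ≠ j → ¬ ∃ σ : Fin 10 ≃ Fin 10, IsIso (Δ i) (Δ j) σ) ∧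
      ∀ i, ∃ ψ : Fin 10 → E3,
        (∀ v k, ∃ m : ℤ, ψ v k = m) ∧
        IsImmersion (Δ i) ψ ∧
        ∃ R : E3 ≃ᵃⁱ[ℝ] E3, IsThreefoldRotation R ∧ IsGeometricSymmetry (Δ i) ψ R :=
  ⟨surfaceComplex, isTriangulationOf_surfaceComplex,
    fun _ _ hij ⟨σ, hσ⟩ => not_isIso_surfaceComplex hij σ hσ,
    fun i => ⟨fun v => latticePoint ((surfaces i).coordinates v), fun _ _ => ⟨_, rfl⟩,
      isImmersion_surfaceComplex i, cyclicIsometry.toAffineIsometryEquiv,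
      isThreefoldRotation_cyclicIsometry, isGeometricSymmetry_surfaceComplex i⟩⟩
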